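/- Let $k$ be a field. For a $k$-algebra map $\varphi:H\to R$ and an $R$-module $M$, the weight space of $\chi\in\mathrm{Hom}_{k\text{-alg}}(H,k)$ is $M_\chi=\{m\in M: hm=\chi(h)m\ \forall h\in H\}$; $M$ is $H$-semisimple if it is the (direct) sum of its weight spaces. **Regular triangular algebras.** A regular triangular algebra (RTA) is an associative unital $k$-algebra $A$ with the following data. (1) Unital subalgebras $B_-,H,B_+$ such that multiplication $B_-\otimes_k H\otimes_k B_+\to A$ is a vector space isomorphism. (2) A $k$-algebra map $\mathrm{ad}:H\to\mathrm{End}_k(A)$ such that every $\mathrm{ad}\,h$ preserves $H$ and $B_\pm$; moreover the images in $A$ of $B_-\otimes H$ and of $H\otimes B_+$ under multiplication are subalgebras. (3) A free action $*$ of a group $P$ on $G=\mathrm{Hom}_{k\text{-alg}}(H,k)$ and a distinguished $0_G\in G$ such that $(\mathrm{ad}\,h)(x)=0_G(h)x$ for $h,x\in H$. (4) A subalgebra $H_0\subseteq H$ and a free abelian group $P_0$ of finite rank acting freely (also written $*$) on $G_0=\mathrm{Hom}_{k\text{-alg}}(H_0,k)$, and a surjective map $\pi:P\to P_0$ with $\pi(\theta*\chi)=\pi(\theta)*\pi(\chi)$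 for $\theta\in P$, $\chi\in G$, where $\pi:G\to G_0$ also denotes restriction. Write $A_\chi$ ($\chi\in G$) for the weight spaces of $A$ under $\mathrm{ad}$, $A_\theta=A_{\theta*0_G}$ for $\theta\in P$, $(B_\pm)_\theta=B_\pm\cap A_\theta$, and, for $\theta_0\in P_0$, $(B_\pm)_{\theta_0}=\bigoplus_{\chi\in G:\ \pi(\chi)=\theta_0*\pi(0_G)}(B_\pm\cap A_\chi)$. (5) A finite basis $\Delta$ of $P_0$ such that $B_\pm=\bigoplus_{\theta\in P:\ \pi(\theta)\in\pm\mathbb Z_{\ge0}\Delta}(B_\pm)_\theta$. (6) $(B_\pm)_0=k$ and $\dim_k(B_\pm)_{\theta_0}<\infty$ for $\theta_0\in\pm\mathbb Z_{\ge0}\Delta$. (7) $A_\theta A_{\theta'}\subseteq A_{\theta\theta'}$ and $A_\theta M_\chi\subseteq M_{\theta*\chi}$ for all $\theta,\theta'\in P$, $\chi\in G$ and all $A$-modules $M$. (8) A $k$-linear anti-involution $i$ of $A$ that is the identity on $H$ and maps $A_\theta$ to $A_{\theta^{-1}}$ for all $\theta\in P$. Put $N_\pm=\bigoplus_{\theta\in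 P:\ \pi(\theta)\ne0}(B_\pm)_\theta$. Order $G_0$ by: $\mu\le\nu$ iff $\nu=\theta_0*\mu$ for some $\theta_0\in\mathbb Z_{\ge0}\Delta$. **Standing assumptions.** Let $A$ be an RTA and $\Gamma$ a finite group acting on $A$ by $k$-algebra automorphisms; if $|\Gamma|>1$, then $k$ has characteristic $0$. Assume: the action of $\Gamma$ and $\mathrm{ad}$ on $H$ together define an algebra map $H\rtimes\Gamma\to\mathrm{End}_k(A)$ under which $k,N_\pm,H_0,H$ are stable; $i(\gamma(a))=\gamma(i(a))$ for all $\gamma\in\Gamma$, $a\in A$; for the induced actions of $\Gamma$ on $G$ and $G_0$, $\langle\gamma(\chi),h\rangle=\langle\chi,\gamma^{-1}(h)\rangle$, each $\gamma$ maps $P*0_G$ to itself and $\gamma(\theta)*\gamma(\chi)=\gamma(\theta*\chi)$ for $\theta\in P$, $\chi\in G$, where $\gamma(\theta)\in P$ is given by $\gamma(\theta)*0_G=\gamma(\theta*0_G)$; and $\Gamma$ acts on $G_0$ by order-preserving maps. **Category, Verma modules.** $A\rtimes\Gamma$ is the skew group ring ($A\otimes_k k\Gamma$ with $\gamma a=\gamma(a)\gamma$).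 $\mathcal O=\mathcal O_{A\rtimes\Gamma}$ is the category of finitely generated $H$-semisimple $A\rtimes\Gamma$-modules $M$ with finite-dimensional weight spaces and $\dim_k B_+m<\infty$ for all $m\in M$; $\mathcal O_A$ is the same for $A$-modules. $X$ is the set of isomorphism classes of simple objects in the category of finite-dimensional $H$-semisimple $(H\rtimes\Gamma)$-modules; for $x\in X$ let $M_x$ be the corresponding module, and let $\lambda_x\in G$ be any weight of $M_x$, i.e. $(M_x)_{\lambda_x}\neq0$ (the weights of $M_x$ form one $\Gamma$-orbit). Put $Z(x)=(A\rtimes\Gamma)\otimes_{(H\otimes B_+)\rtimes\Gamma}M_x$, with $N_+$ acting by $0$ on $M_x$, and for $\lambda\in G$ put $Z_A(\lambda)=A/\bigl(AN_++\sum_{h\in H}A(h-\lambda(h))\bigr)$. **Theorem.** Each $Z(x)$ ($x\in X$) lies in $\mathcal O$ and has a unique maximal submodule, and each $Z_A(\lambda)$ ($\lambda\in G$) lies in $\mathcal O_A$ and has a unique maximal submodule; let $V(x)$ and $V_A(\lambda)$ be the corresponding simple quotients (which lie in $\mathcal O$ and $\mathcal O_A$ respectively). Then: 1. Every simple module in $\mathcal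 O_{A\rtimes\Gamma}$ is isomorphic to $V(x)$ for some $x\in X$. 2. For $x\in X$, $V(x)$ is finite-dimensional if and only if $V_A(\lambda_x)$ is finite-dimensional. 3. For $x\in X$, $Z(x)$ has finite length if and only if $Z_A(\lambda_x)$ has finite length. -/

import Mathlib

open scoped TensorProduct

universe v w

/-! ### Weight spaces -/

section Weights

variable {k H R : Type*} [Field k] [Ring H] [Algebra k H] [Ring R] [Algebra k R]

/-- The weight space `M_χ = {m : h m = χ(h) m for all h ∈ H}` of a module `M` over an algebra `R`
on which `H` acts through an algebra map `φ : H → R`. -/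
def weightSpace (φ : H →ₐ[k] R) (M : Type*) [AddCommGroup M] [Module k M] [Module R M]
    [IsScalarTower k R M] (χ : H →ₐ[k] k) : Submodule k M where
  carrier := {m | ∀ h : H, φ h • m = χ h • m}
  add_mem' := by
    intro a b ha hb h
    rw [smul_add, smul_add, ha h, hb h]
  zero_mem' := by
    intro h
    rw [smul_zero, smul_zero]
  smul_mem' := by
    intro c m hm h
    rw [smul_algebra_smul_comm, hm h, smul_comm]

/-- `M` is `H`-semisimple: it is the sum of its `H`-weight spaces. (Such a sum is always direct,
since weight vectors for distinct weights are linearly independent.) -/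
def IsHSemisimple (φ : H →ₐ[k] R) (M : Type*) [AddCommGroup M] [Module k M] [Module R M]
    [IsScalarTower k R M] : Prop :=
  ⨆ χ : H →ₐ[k] k, weightSpace φ M χ = ⊤

end Weights

/-! ### Regular triangular algebras -/

/-- The multiplication map `B₁ ⊗ B₂ ⊗ B₃ → A` for three subalgebras of `A`. -/
noncomputable def tripleMul {k A : Type*} [Field k] [Ring A] [Algebra k A]
    (B₁ B₂ B₃ : Subalgebra k A) : (B₁ ⊗[k] B₂) ⊗[k] B₃ →ₗ[k] A :=
  LinearMap.mul' k A ∘ₗ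
    TensorProduct.map
      (LinearMap.mul' k A ∘ₗ TensorProduct.map B₁.val.toLinearMap B₂.val.toLinearMap)
      B₃.val.toLinearMap

/-- A regular triangular algebra (RTA) structure on the associative `k`-algebra `A`, with the group
`P` (written multiplicatively) and the root lattice `P₀` (written additively), a free abelian group
of rank `r`.  The sets of weights are `G = Hom_{k-alg}(H, k)` and `G₀ = Hom_{k-alg}(H₀, k)`. -/
structure RTA (k : Type*) (A : Type v) (P : Type*) (P₀ : Type*) (r : ℕ)
    [Field k] [Ring A] [Algebra k A] [Group P] [AddCommGroup P₀] where
  /-- the subalgebra `B₋` -/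
  Bm : Subalgebra k A
  /-- the Cartan part `H` -/
  H : Subalgebra k A
  /-- the subalgebra `B₊` -/
  Bp : Subalgebra k A
  /-- triangular decomposition `B₋ ⊗ H ⊗ B₊ ≅ A` -/
  triangular : Function.Bijective (tripleMul Bm H Bp)
  /-- the algebra map `ad : H → End_k(A)` -/
  ad : H →ₐ[k] Module.End k A
  ad_H : ∀ h : H, ∀ x ∈ H, ad h x ∈ H
  ad_Bm : ∀ h : H, ∀ x ∈ Bm, ad h x ∈ Bm
  ad_Bp : ∀ h : H, ∀ x ∈ Bp, ad h x ∈ Bp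
  /-- the image of `B₋ ⊗ H` is closed under multiplication -/
  Bm_H_subalgebra : (Subalgebra.toSubmodule Bm * Subalgebra.toSubmodule H) *
      (Subalgebra.toSubmodule Bm * Subalgebra.toSubmodule H) ≤
      Subalgebra.toSubmodule Bm * Subalgebra.toSubmodule H
  /-- the image of `H ⊗ B₊` is closed under multiplication -/
  H_Bp_subalgebra : (Subalgebra.toSubmodule H * Subalgebra.toSubmodule Bp) *
      (Subalgebra.toSubmodule H * Subalgebra.toSubmodule Bp) ≤
      Subalgebra.toSubmodule H * Subalgebra.toSubmodule Bp
  /-- the action `*` of the group `P` on `G` -/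
  act : P →* Equiv.Perm (H →ₐ[k] k)
  act_free : ∀ (θ : P) (χ : H →ₐ[k] k), act θ χ = χ → θ = 1
  /-- the distinguished weight `0_G` -/
  zeroG : H →ₐ[k] k
  /-- `H = H_{0_G}` as an `ad H`-module -/
  ad_on_H : ∀ h x : H, ad h (x : A) = zeroG h • (x : A)
  /-- the subalgebra `H₀` of `H` -/
  H₀ : Subalgebra k A
  H₀_le : H₀ ≤ H
  /-- the action `*` of the group `P₀` on `G₀` -/
  act₀ : Multiplicative P₀ →* Equiv.Perm (H₀ →ₐ[k] k)
  act₀_free : ∀ (θ : Multiplicative P₀) (χ : H₀ →ₐ[k] k), act₀ θ χ = χ → θ = 1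
  /-- the map `P → P₀` induced by restriction `π : G → G₀`; it is determined by the other data,
  because `P₀` acts freely -/
  proj : P → P₀
  proj_surjective : Function.Surjective proj
  /-- `π(θ * χ) = π(θ) * π(χ)` -/
  restrict_act : ∀ (θ : P) (χ : H →ₐ[k] k),
    (act θ χ).comp (Subalgebra.inclusion H₀_le) =
      act₀ (Multiplicative.ofAdd (proj θ)) (χ.comp (Subalgebra.inclusion H₀_le))
  /-- the simple roots `Δ`, a basis of `P₀` -/
  Δ : Module.Basis (Fin r) ℤ P₀
  /-- `B₊` is the direct sum of the `(B₊)_θ` with `π(θ) ∈ ℤ_{≥0} Δ` -/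
  Bp_weights : Subalgebra.toSubmodule Bp =
    ⨆ (θ : P) (_ : ∀ i, 0 ≤ Δ.repr (proj θ) i),
      Subalgebra.toSubmodule Bp ⊓ weightSpace ad A (act θ zeroG)
  /-- `B₋` is the direct sum of the `(B₋)_θ` with `π(θ) ∈ -ℤ_{≥0} Δ` -/
  Bm_weights : Subalgebra.toSubmodule Bm =
    ⨆ (θ : P) (_ : ∀ i, Δ.repr (proj θ) i ≤ 0),
      Subalgebra.toSubmodule Bm ⊓ weightSpace ad A (act θ zeroG)
  /-- `(B₊)₀ = k` -/
  Bp_zero : (⨆ (χ : H →ₐ[k] k) (_ : χ.comp (Subalgebra.inclusion H₀_le) =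
        zeroG.comp (Subalgebra.inclusion H₀_le)),
      Subalgebra.toSubmodule Bp ⊓ weightSpace ad A χ) = Submodule.span k {(1 : A)}
  /-- `(B₋)₀ = k` -/
  Bm_zero : (⨆ (χ : H →ₐ[k] k) (_ : χ.comp (Subalgebra.inclusion H₀_le) =
        zeroG.comp (Subalgebra.inclusion H₀_le)),
      Subalgebra.toSubmodule Bm ⊓ weightSpace ad A χ) = Submodule.span k {(1 : A)}
  /-- `dim (B₊)_{θ₀} < ∞` for `θ₀ ∈ ℤ_{≥0} Δ` -/
  Bp_finite : ∀ θ₀ : P₀, (∀ i, 0 ≤ Δ.repr θ₀ i) → FiniteDimensional k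
    ↥(⨆ (χ : H →ₐ[k] k) (_ : χ.comp (Subalgebra.inclusion H₀_le) =
        act₀ (Multiplicative.ofAdd θ₀) (zeroG.comp (Subalgebra.inclusion H₀_le))),
      Subalgebra.toSubmodule Bp ⊓ weightSpace ad A χ)
  /-- `dim (B₋)_{θ₀} < ∞` for `θ₀ ∈ -ℤ_{≥0} Δ` -/
  Bm_finite : ∀ θ₀ : P₀, (∀ i, Δ.repr θ₀ i ≤ 0) → FiniteDimensional k
    ↥(⨆ (χ : H →ₐ[k] k) (_ : χ.comp (Subalgebra.inclusion H₀_le) =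
        act₀ (Multiplicative.ofAdd θ₀) (zeroG.comp (Subalgebra.inclusion H₀_le))),
      Subalgebra.toSubmodule Bm ⊓ weightSpace ad A χ)
  /-- property of weights, first half: `A_θ A_θ' ⊆ A_{θ * θ'}` -/
  weight_mul : ∀ (θ θ' : P) (a a' : A), a ∈ weightSpace ad A (act θ zeroG) →
    a' ∈ weightSpace ad A (act θ' zeroG) → a * a' ∈ weightSpace ad A (act (θ * θ') zeroG)
  /-- property of weights, second half: `A_θ M_χ ⊆ M_{θ * χ}` for every `A`-module `M` (modules in
  the universe of `A` suffice, as the cyclic modules `A / ∑ A (h - χ(h))` are universal here) -/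
  weight_smul : ∀ (M : Type v) [AddCommGroup M] [Module A M] (θ : P) (χ : H →ₐ[k] k) (a : A)
    (m : M), a ∈ weightSpace ad A (act θ zeroG) →
    (∀ h : H, (h : A) • m = algebraMap k A (χ h) • m) →
    ∀ h : H, (h : A) • a • m = algebraMap k A (act θ χ h) • a • m
  /-- the anti-involution `i` of `A` -/
  inv : A →ₗ[k] A
  inv_mul : ∀ a b, inv (a * b) = inv b * inv a
  inv_inv : ∀ a, inv (inv a) = a
  inv_H : ∀ h ∈ H, inv h = h
  inv_weight : ∀ (θ : P) (a : A), a ∈ weightSpace ad A (act θ zeroG) →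
    inv a ∈ weightSpace ad A (act θ⁻¹ zeroG)

namespace RTA

section Basic

variable {k A P P₀ : Type*} {r : ℕ} [Field k] [Ring A] [Algebra k A] [Group P] [AddCommGroup P₀]

/-- The augmentation ideal `N₊` of `B₊`: the sum of the `(B₊)_θ` with `π(θ) ≠ 0`. -/
def Np (D : RTA k A P P₀ r) : Submodule k A :=
  ⨆ (θ : P) (_ : D.proj θ ≠ 0),
    Subalgebra.toSubmodule D.Bp ⊓ weightSpace D.ad A (D.act θ D.zeroG)

/-- The augmentation ideal `N₋` of `B₋`: the sum of the `(B₋)_θ` with `π(θ) ≠ 0`. -/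
def Nm (D : RTA k A P P₀ r) : Submodule k A :=
  ⨆ (θ : P) (_ : D.proj θ ≠ 0),
    Subalgebra.toSubmodule D.Bm ⊓ weightSpace D.ad A (D.act θ D.zeroG)

/-- The partial order on `G₀`: `μ ≤ ν` iff `ν = θ₀ * μ` for some `θ₀ ∈ ℤ_{≥0} Δ`. -/
def le₀ (D : RTA k A P P₀ r) (μ ν : D.H₀ →ₐ[k] k) : Prop :=
  ∃ θ₀ : P₀, (∀ i, 0 ≤ D.Δ.repr θ₀ i) ∧ D.act₀ (Multiplicative.ofAdd θ₀) μ = ν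

end Basic

/-! ### Group actions and the standing assumptions on the skew group ring -/

section Dual

variable {k A Γ : Type*} [Field k] [Ring A] [Algebra k A] [Group Γ] [MulSemiringAction Γ A]
  [SMulCommClass Γ k A]

/-- The action of `γ` on a `Γ`-stable subalgebra `B` of `A`. -/
def actOn (B : Subalgebra k A) (hB : ∀ γ : Γ, ∀ x ∈ B, γ • x ∈ B) (γ : Γ) : B →ₐ[k] B :=
  ((MulSemiringAction.toAlgHom k A γ).comp B.val).codRestrict B (fun x => hB γ x x.2)

/-- The action of `Γ` on the weights of a `Γ`-stable subalgebra:
`⟨γ(χ), b⟩ = ⟨χ, γ⁻¹(b)⟩`. -/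
def dualAct (B : Subalgebra k A) (hB : ∀ γ : Γ, ∀ x ∈ B, γ • x ∈ B) (γ : Γ)
    (χ : B →ₐ[k] k) : B →ₐ[k] k :=
  χ.comp (actOn B hB γ⁻¹)

end Dual

/-- The standing assumptions on a group `Γ` acting on the RTA `A` by `k`-algebra automorphisms. -/
structure SkewCompatible {k A P P₀ : Type*} {r : ℕ} [Field k] [Ring A] [Algebra k A] [Group P]
    [AddCommGroup P₀] (D : RTA k A P P₀ r) (Γ : Type*) [Group Γ] [MulSemiringAction Γ A]
    [SMulCommClass Γ k A] : Prop where
  finite : Finite Γ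
  charZero : Nontrivial Γ → CharZero k
  smul_H : ∀ γ : Γ, ∀ x ∈ D.H, γ • x ∈ D.H
  smul_H₀ : ∀ γ : Γ, ∀ x ∈ D.H₀, γ • x ∈ D.H₀
  smul_Np : ∀ γ : Γ, ∀ x ∈ D.Np, γ • x ∈ D.Np
  smul_Nm : ∀ γ : Γ, ∀ x ∈ D.Nm, γ • x ∈ D.Nm
  ad_k : ∀ h : D.H, ∀ x ∈ Submodule.span k {(1 : A)}, D.ad h x ∈ Submodule.span k {(1 : A)}
  ad_H₀ : ∀ h : D.H, ∀ x ∈ D.H₀, D.ad h x ∈ D.H₀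
  ad_Np : ∀ h : D.H, ∀ x ∈ D.Np, D.ad h x ∈ D.Np
  ad_Nm : ∀ h : D.H, ∀ x ∈ D.Nm, D.ad h x ∈ D.Nm
  /-- `Ad` on `Γ` and `ad` on `H` fit together to an algebra map `H ⋊ Γ → End_k(A)`: the relation
  `γ h = γ(h) γ` is respected -/
  smul_ad : ∀ (γ : Γ) (h : D.H) (a : A), γ • D.ad h a = D.ad (actOn D.H smul_H γ h) (γ • a)
  /-- `i(γ(a)) = γ(i(a))` -/
  inv_smul : ∀ (γ : Γ) (a : A), D.inv (γ • a) = γ • D.inv a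
  /-- `γ` maps `P * 0_G` to itself, and `γ(θ) * γ(χ) = γ(θ * χ)`; here `γ(θ)` is the (unique)
  element `θ'` of `P` with `θ' * 0_G = γ(θ * 0_G)` -/
  smul_act : ∀ (γ : Γ) (θ : P), ∃ θ' : P,
    D.act θ' D.zeroG = dualAct D.H smul_H γ (D.act θ D.zeroG) ∧
    ∀ χ : D.H →ₐ[k] k, D.act θ' (dualAct D.H smul_H γ χ) = dualAct D.H smul_H γ (D.act θ χ)
  /-- `Γ` acts on `G₀` by order-preserving transformations -/
  order : ∀ (γ : Γ) (μ ν : D.H₀ →ₐ[k] k), D.le₀ μ ν →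
    D.le₀ (dualAct D.H₀ smul_H₀ γ μ) (dualAct D.H₀ smul_H₀ γ ν)

/-! ### The skew group rings -/

section Skew

variable {k A P P₀ : Type*} {r : ℕ} [Field k] [Ring A] [Algebra k A] [Group P] [AddCommGroup P₀]

variable (k A) in
/-- The embedding `A → A ⋊ Γ`, where `A ⋊ Γ` is the skew group ring (the formal sums
`∑ a_γ γ` with `γ a = γ(a) γ`). -/
noncomputable def toSkew (Γ : Type*) [Group Γ] [MulSemiringAction Γ A] [SMulCommClass Γ k A] :
    A →ₐ[k] SkewMonoidAlgebra A Γ :=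
  { SkewMonoidAlgebra.singleOneRingHom with commutes' := fun _ => rfl }

variable (D : RTA k A P P₀ r) (Γ : Type*) [Group Γ] [MulSemiringAction Γ A] [SMulCommClass Γ k A]

/-- `H ⋊ Γ`, realized as the subalgebra of `A ⋊ Γ` generated by `H` and `Γ`. -/
noncomputable def HΓ : Subalgebra k (SkewMonoidAlgebra A Γ) :=
  Algebra.adjoin k ((toSkew k A Γ '' D.H) ∪ Set.range (SkewMonoidAlgebra.of A Γ))

/-- The embedding `H → H ⋊ Γ`. -/
noncomputable def toHΓ : D.H →ₐ[k] D.HΓ Γ :=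
  ((toSkew k A Γ).comp D.H.val).codRestrict (D.HΓ Γ)
    (fun h => Algebra.subset_adjoin (Or.inl ⟨h, h.2, rfl⟩))

/-- An element of `X`: a simple object of the category of finite-dimensional `H`-semisimple
`(H ⋊ Γ)`-modules. -/
structure X where
  /-- the underlying space, `M_x` -/
  carrier : Type w
  [addCommGroup : AddCommGroup carrier]
  [moduleK : Module k carrier]
  [moduleHΓ : Module (D.HΓ Γ) carrier]
  [isScalarTower : IsScalarTower k (D.HΓ Γ) carrier]
  finiteDimensional : FiniteDimensional k carrier
  semisimple : IsHSemisimple (D.toHΓ Γ) carrier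
  simple : IsSimpleModule (D.HΓ Γ) carrier

attribute [instance] X.addCommGroup X.moduleK X.moduleHΓ X.isScalarTower

/-- `χ ∈ λ_x`: the `Γ`-orbit `λ_x` is the set of weights of `M_x`. -/
def X.IsWeight {D : RTA k A P P₀ r} {Γ : Type*} [Group Γ] [MulSemiringAction Γ A]
    [SMulCommClass Γ k A] (x : D.X Γ) (χ : D.H →ₐ[k] k) : Prop :=
  weightSpace (D.toHΓ Γ) x.carrier χ ≠ ⊥

end Skew

/-! ### The BGG category -/

/-- The objects of the BGG category `𝒪`: finitely generated `H`-semisimple `R`-modules with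
finite-dimensional weight spaces and a locally finite action of `B₊`. Here `R` is an algebra with
an algebra map `φ : A → R`; it is used for `R = A ⋊ Γ` and for `R = A`. -/
structure InO {k A P P₀ : Type*} {r : ℕ} [Field k] [Ring A] [Algebra k A] [Group P]
    [AddCommGroup P₀] (D : RTA k A P P₀ r) {R : Type*} [Ring R] [Algebra k R] (φ : A →ₐ[k] R)
    (M : Type*) [AddCommGroup M] [Module k M] [Module R M] [IsScalarTower k R M] : Prop where
  finitelyGenerated : Module.Finite R M
  semisimple : IsHSemisimple (φ.comp D.H.val) M
  finite_weightSpace : ∀ χ : D.H →ₐ[k] k,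
    FiniteDimensional k (weightSpace (φ.comp D.H.val) M χ)
  locallyFinite : ∀ m : M,
    FiniteDimensional k (Submodule.span k {m' : M | ∃ b ∈ D.Bp, m' = φ b • m})

/-! ### Verma modules and their simple quotients -/

/-- The sum of all proper submodules of `M`. If `M` has a largest proper submodule, this is it. -/
def sumProper (R M : Type*) [Ring R] [AddCommGroup M] [Module R M] : Submodule R M :=
  sSup {N | N ≠ ⊤}

section Verma

variable {k A P P₀ : Type*} {r : ℕ} [Field k] [Ring A] [Algebra k A] [Group P] [AddCommGroup P₀]
variable (D : RTA k A P P₀ r)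

/-- The relations `s ⊗ e = 1 ⊗ s e` (`s ∈ H ⋊ Γ`) and `n ⊗ e = 0` (`n ∈ N₊`) in
`(A ⋊ Γ) ⊗_k E`. -/
noncomputable def vermaRel (Γ : Type*) [Group Γ] [MulSemiringAction Γ A] [SMulCommClass Γ k A]
    (E : Type*) [AddCommGroup E] [Module k E] [Module (D.HΓ Γ) E] [IsScalarTower k (D.HΓ Γ) E] :
    Submodule (SkewMonoidAlgebra A Γ) (SkewMonoidAlgebra A Γ ⊗[k] E) :=
  Submodule.span (SkewMonoidAlgebra A Γ)
    ({z | ∃ (s : D.HΓ Γ) (e : E), z = (s : SkewMonoidAlgebra A Γ) ⊗ₜ[k] e - 1 ⊗ₜ[k] (s • e)} ∪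
     {z | ∃ n ∈ D.Np, ∃ e : E, z = toSkew k A Γ n ⊗ₜ[k] e})

/-- The Verma module `Z(x) = (A ⋊ Γ) ⊗_{(H ⊗ B₊) ⋊ Γ} M_x`, where `N₊` acts by zero on `M_x`;
the ring `(H ⊗ B₊) ⋊ Γ` is generated by `H ⋊ Γ` and `N₊`. -/
abbrev Z {D : RTA k A P P₀ r} {Γ : Type*} [Group Γ] [MulSemiringAction Γ A] [SMulCommClass Γ k A]
    (x : D.X Γ) : Type _ :=
  (SkewMonoidAlgebra A Γ ⊗[k] x.carrier) ⧸ D.vermaRel Γ x.carrier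

/-- The module `V(x)`, the quotient of `Z(x)` by its largest proper submodule. -/
abbrev V {D : RTA k A P P₀ r} {Γ : Type*} [Group Γ] [MulSemiringAction Γ A] [SMulCommClass Γ k A]
    (x : D.X Γ) : Type _ :=
  Z x ⧸ sumProper (SkewMonoidAlgebra A Γ) (Z x)

/-- The left ideal of `A` generated by `N₊` and all `h - χ(h)`, `h ∈ H`. -/
def vermaIdeal (χ : D.H →ₐ[k] k) : Submodule A A :=
  Submodule.span A ((D.Np : Set A) ∪ {z | ∃ h : D.H, z = (h : A) - algebraMap k A (χ h)})

/-- The Verma module `Z_A(χ) = A / (A N₊ + ∑ A (h - χ(h)))` over `A`. -/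
abbrev ZA (χ : D.H →ₐ[k] k) : Type _ := A ⧸ D.vermaIdeal χ

/-- The module `V_A(χ)`, the quotient of `Z_A(χ)` by its largest proper submodule. -/
abbrev VA (χ : D.H →ₐ[k] k) : Type _ := D.ZA χ ⧸ sumProper A (D.ZA χ)

end Verma

end RTA

/-!
# Verma modules and simple modules over the skew group ring of a regular triangular algebra

The triangular decomposition makes `B₋ ⊗ E` a model of the module induced from a representation `E`
of `H` on which `N₊` acts by zero (`RTA.exists_induced`, `RTA.exists_induced_skew`). What makes the
model consistent is `N₊ H ⊆ H N₊` (`RTA.Np_mul_H`), a consequence of comparing weights under `ad`.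
Hence `Z_A(χ)` and `Z(x)` are nonzero, and `Z_A(χ)` embeds into `Z(x)` for each weight `χ` of `M_x`.

Conversely, `A e = B₋ e` for a highest weight vector `e`, so `A e` consists of the multiples of `e`
and of vectors of strictly lower `H₀`-weights (`RTA.IsHighest.range_le`). The simple module `M_x` is
spanned by the finitely many `Γ`-translates of one weight vector, so `Z(x)` is generated over `A`
by finitely many highest weight vectors, and any such module lies in `𝒪` (`RTA.inO_of_isHighest`).
Since `Γ` is finite and preserves the order on `G₀`, its orbits there are antichains; therefore the
weights of `M_x` are separated from all other weights of `Z(x)`. A proper submodule is graded by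
weights and meets the simple module `M_x` trivially, so it lies in the sum of the other weight
spaces, and so does the sum of all proper submodules (`IsTopComponent`).

* A simple module in `𝒪` contains a highest weight vector, whose `Γ`-translates span a
  finite-dimensional `H ⋊ Γ`-module; any simple submodule `M_x` of that gives a surjection from
  `Z(x)`, and so an isomorphism with `V(x)` (`RTA.exists_equiv_V`).
* For a weight vector `e` of `M_x` of weight `χ`, an element `a` of `A` sends `e` into the maximal
  submodule of `Z(x)` if and only if it sends the generator of `Z_A(χ)` into the maximal submodule
  of `Z_A(χ)`. So `V_A(χ)` embeds into `V(x)`, which is the sum of the finitely many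
  `Γ`-translates of its image (`RTA.finiteDimensional_V_iff`).
* A module of finite length over `A ⋊ Γ` has finite length over `A` by Clifford theory
  (`SkewMonoidAlgebra.isFiniteLength_restrictScalars`), and `Z(x)` is the sum of the finitely many
  translates of a copy of `Z_A(χ)` (`RTA.isFiniteLength_Z_iff`).
-/

/-! ### Sums of weight spaces -/

section WeightSums

variable {k H R M : Type*} [Field k] [Ring H] [Algebra k H] [Ring R] [Algebra k R]
  [AddCommGroup M] [Module k M] [Module R M] [IsScalarTower k R M]

/-- The sum of the weight spaces `M_χ` over a set `S` of weights. -/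
def weightSum (φ : H →ₐ[k] R) (M : Type*) [AddCommGroup M] [Module k M] [Module R M]
    [IsScalarTower k R M] (S : Set (H →ₐ[k] k)) : Submodule k M :=
  ⨆ χ ∈ S, weightSpace φ M χ

variable {φ : H →ₐ[k] R}

theorem weightSpace_le_weightSum {S : Set (H →ₐ[k] k)} {χ : H →ₐ[k] k} (hχ : χ ∈ S) :
    weightSpace φ M χ ≤ weightSum φ M S :=
  le_iSup₂_of_le χ hχ le_rfl

theorem weightSum_mono {S T : Set (H →ₐ[k] k)} (h : S ⊆ T) :
    weightSum φ M S ≤ weightSum φ M T :=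
  iSup₂_le fun _ hχ => weightSpace_le_weightSum (h hχ)

theorem weightSum_le {S : Set (H →ₐ[k] k)} {N : Submodule k M}
    (h : ∀ χ ∈ S, weightSpace φ M χ ≤ N) : weightSum φ M S ≤ N :=
  iSup₂_le h

theorem weightSum_union (S T : Set (H →ₐ[k] k)) :
    weightSum φ M (S ∪ T) = weightSum φ M S ⊔ weightSum φ M T :=
  iSup_union

theorem algHom_smul_comm (a : R) (c : k) (m : M) : a • c • m = c • a • m :=
  smul_algebra_smul_comm c a m

theorem exists_eq_one_eq_zero {χ ψ : H →ₐ[k] k} (h : χ ≠ ψ) : ∃ x : H, χ x = 1 ∧ ψ x = 0 := by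
  obtain ⟨x, hx⟩ : ∃ x, χ x ≠ ψ x := by
    by_contra! hc
    exact h (AlgHom.ext hc)
  refine ⟨(χ x - ψ x)⁻¹ • (x - algebraMap k H (ψ x)), ?_, ?_⟩
  · simp [inv_mul_cancel₀ (sub_ne_zero.2 hx)]
  · simp

theorem exists_eq_one_forall_eq_zero (χ : H →ₐ[k] k) (F : Finset (H →ₐ[k] k)) (hF : χ ∉ F) :
    ∃ x : H, χ x = 1 ∧ ∀ ψ ∈ F, ψ x = 0 := by
  classical
  induction F using Finset.induction_on with
  | empty => exact ⟨1, map_one _, by simp⟩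
  | insert ψ F _ ih =>
    rw [Finset.mem_insert, not_or] at hF
    obtain ⟨x, hx1, hx0⟩ := ih hF.2
    obtain ⟨y, hy1, hy0⟩ := exists_eq_one_eq_zero hF.1
    refine ⟨x * y, by simp [hx1, hy1], fun ρ hρ => ?_⟩
    rcases Finset.mem_insert.1 hρ with rfl | hρ
    · simp [hy0]
    · simp [hx0 ρ hρ]

/-- Finitely many weights of an algebra can be separated by an element of that algebra: the
Chinese remainder theorem for the kernels of the weights. -/
theorem exists_separating (F F' : Finset (H →ₐ[k] k)) (hF : Disjoint F F') :
    ∃ x : H, (∀ χ ∈ F, χ x = 1) ∧ ∀ ψ ∈ F', ψ x = 0 := by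
  classical
  induction F using Finset.induction_on with
  | empty => exact ⟨0, by simp, by simp⟩
  | insert χ F _ ih =>
    rw [Finset.disjoint_insert_left] at hF
    obtain ⟨x, hx1, hx0⟩ := ih hF.2
    obtain ⟨y, hy1, hy0⟩ := exists_eq_one_forall_eq_zero χ F' hF.1
    -- `1 - (1 - x) (1 - y)` takes the value `1` wherever `x` or `y` does
    refine ⟨x + y - x * y, fun ρ hρ => ?_, fun ρ hρ => by simp [hx0 ρ hρ, hy0 ρ hρ]⟩
    rcases Finset.mem_insert.1 hρ with rfl | hρ
    · simp [hy1]
    · simp [hx1 ρ hρ]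

theorem exists_finset_mem_weightSum {S : Set (H →ₐ[k] k)} {m : M} (hm : m ∈ weightSum φ M S) :
    ∃ F : Finset (H →ₐ[k] k), ↑F ⊆ S ∧ m ∈ weightSum φ M ↑F := by
  classical
  refine Submodule.iSup_induction' (p := fun χ => ⨆ _ : χ ∈ S, weightSpace φ M χ)
    (motive := fun m _ => ∃ F : Finset (H →ₐ[k] k), ↑F ⊆ S ∧ m ∈ weightSum φ M ↑F)
    ?_ ?_ ?_ hm
  · intro χ m hm
    by_cases hχ : χ ∈ S
    · rw [iSup_pos hχ] at hm
      exact ⟨{χ}, by simpa using hχ, weightSpace_le_weightSum (by simp) hm⟩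
    · rw [iSup_neg hχ, Submodule.mem_bot] at hm
      exact ⟨∅, by simp, hm ▸ zero_mem _⟩
  · exact ⟨∅, by simp, zero_mem _⟩
  · rintro m m' _ _ ⟨F, hF, h⟩ ⟨F', hF', h'⟩
    refine ⟨F ∪ F', by simp [hF, hF'], add_mem ?_ ?_⟩
    · exact weightSum_mono (by simp) h
    · exact weightSum_mono (by simp) h'

theorem smul_eq_of_forall_eq {S : Set (H →ₐ[k] k)} {h : H} {c : k} (hc : ∀ χ ∈ S, χ h = c)
    {m : M} (hm : m ∈ weightSum φ M S) : φ h • m = c • m := by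
  have : weightSum φ M S ≤
      LinearMap.eqLocus (Algebra.lsmul k k M (φ h)) (c • LinearMap.id) :=
    weightSum_le fun χ hχ m hm => by
      change φ h • m = c • m
      rw [hm h, hc χ hχ]
  exact this hm

/-- Disjoint sets of weights are separated by the action of a single element of `H`. -/
theorem exists_smul_eq_self_smul_eq_zero {S T : Set (H →ₐ[k] k)} (hST : Disjoint S T) {e l : M}
    (he : e ∈ weightSum φ M S) (hl : l ∈ weightSum φ M T) :
    ∃ h : H, φ h • e = e ∧ φ h • l = 0 := by
  obtain ⟨F, hF, he⟩ := exists_finset_mem_weightSum he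
  obtain ⟨F', hF', hl⟩ := exists_finset_mem_weightSum hl
  obtain ⟨h, h1, h0⟩ := exists_separating F F'
    (Finset.disjoint_coe.1 (hST.mono hF hF'))
  refine ⟨h, ?_, ?_⟩
  · rw [smul_eq_of_forall_eq (c := 1) h1 he, one_smul]
  · rw [smul_eq_of_forall_eq (c := 0) h0 hl, zero_smul]

/-- An `H`-stable subspace contains the components of its elements. -/
theorem mem_of_add_mem {S T : Set (H →ₐ[k] k)} (hST : Disjoint S T) {N : Submodule k M}
    (hN : ∀ h : H, ∀ m ∈ N, φ h • m ∈ N) {e l : M}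
    (he : e ∈ weightSum φ M S) (hl : l ∈ weightSum φ M T) (h : e + l ∈ N) : e ∈ N := by
  obtain ⟨x, hx1, hx0⟩ := exists_smul_eq_self_smul_eq_zero hST he hl
  have := hN x _ h
  rwa [smul_add, hx1, hx0, add_zero] at this

theorem eq_zero_of_mem_weightSum {S T : Set (H →ₐ[k] k)} (hST : Disjoint S T) {m : M}
    (hS : m ∈ weightSum φ M S) (hT : m ∈ weightSum φ M T) : m = 0 := by
  obtain ⟨x, hx1, hx0⟩ := exists_smul_eq_self_smul_eq_zero hST hS hT
  rw [← hx1, hx0]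

theorem isHSemisimple_iff : IsHSemisimple φ M ↔ weightSum φ M Set.univ = ⊤ := by
  simp [IsHSemisimple, weightSum]

/-- An `H`-stable subspace of a sum of weight spaces is graded by weights. -/
theorem mem_iSup_inf_weightSpace {N : Submodule k M} (hN : ∀ h : H, ∀ m ∈ N, φ h • m ∈ N)
    {S : Set (H →ₐ[k] k)} {m : M} (hm : m ∈ N) (hS : m ∈ weightSum φ M S) :
    m ∈ ⨆ χ ∈ S, N ⊓ weightSpace φ M χ := by
  classical
  obtain ⟨F, hF, hmF⟩ := exists_finset_mem_weightSum hS
  clear hS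
  induction F using Finset.induction_on generalizing m with
  | empty =>
    simp only [weightSum, Finset.coe_empty, Set.mem_empty_iff_false, iSup_false, iSup_bot,
      Submodule.mem_bot] at hmF
    exact hmF ▸ zero_mem _
  | insert χ F hχ ih =>
    rw [Finset.coe_insert, Set.insert_subset_iff] at hF
    rw [Finset.coe_insert, Set.insert_eq, weightSum_union] at hmF
    obtain ⟨e, he, l, hl, rfl⟩ := Submodule.mem_sup.1 hmF
    have heN := mem_of_add_mem (by simpa using hχ) hN he hl hm
    have he' : e ∈ weightSpace φ M χ := by simpa [weightSum] using he
    refine add_mem (le_iSup₂_of_le (f := fun χ (_ : χ ∈ S) => N ⊓ weightSpace φ M χ)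
      χ hF.1 le_rfl ⟨heN, he'⟩) (ih ?_ hF.2 hl)
    have := N.sub_mem hm heN
    rwa [add_sub_cancel_left] at this

end WeightSums

/-! ### The structure of a regular triangular algebra -/

namespace RTA

section Structure

variable {k A P P₀ : Type*} {r : ℕ} [Field k] [Ring A] [Algebra k A] [Group P] [AddCommGroup P₀]
variable (D : RTA k A P P₀ r)

/-- The restriction `π : G → G₀` of weights from `H` to `H₀`. -/
def res (χ : D.H →ₐ[k] k) : D.H₀ →ₐ[k] k :=
  χ.comp (Subalgebra.inclusion D.H₀_le)

/-- Membership in the positive cone `ℤ_{≥0} Δ`. -/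
def Nonneg (p : P₀) : Prop := ∀ i, 0 ≤ D.Δ.repr p i

/-- The homogeneous component `A_θ = A_{θ * 0_G}`. -/
abbrev component (θ : P) : Submodule k A := weightSpace D.ad A (D.act θ D.zeroG)

theorem Nonneg.add {D : RTA k A P P₀ r} {p q : P₀} (hp : D.Nonneg p) (hq : D.Nonneg q) :
    D.Nonneg (p + q) := fun i => by
  have := hp i
  have := hq i
  simp only [map_add, Finsupp.add_apply]
  lia

theorem Nonneg.eq_zero {D : RTA k A P P₀ r} {p : P₀} (hp : D.Nonneg p) (hn : D.Nonneg (-p)) :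
    p = 0 := by
  apply D.Δ.repr.injective
  ext i
  have h1 := hp i
  have h2 := hn i
  simp only [map_neg, Finsupp.neg_apply] at h2
  simp only [map_zero, Finsupp.zero_apply]
  lia

theorem nonneg_neg_iff {p : P₀} : D.Nonneg (-p) ↔ ∀ i, D.Δ.repr p i ≤ 0 := by
  simp [Nonneg]

theorem act_one (χ : D.H →ₐ[k] k) : D.act 1 χ = χ := by simp

theorem act_injective {θ θ' : P} {χ : D.H →ₐ[k] k} (h : D.act θ χ = D.act θ' χ) : θ = θ' := by
  have : D.act (θ'⁻¹ * θ) χ = χ := by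
    rw [map_mul, Equiv.Perm.mul_apply, h, ← Equiv.Perm.mul_apply, ← map_mul, inv_mul_cancel,
      act_one]
  exact (inv_mul_eq_one.1 (D.act_free _ _ this)).symm

/-- The action of `P₀` on `G₀`, written additively. -/
def shift (p : P₀) (μ : D.H₀ →ₐ[k] k) : D.H₀ →ₐ[k] k := D.act₀ (Multiplicative.ofAdd p) μ

theorem shift_add (p q : P₀) (μ : D.H₀ →ₐ[k] k) :
    D.shift (p + q) μ = D.shift p (D.shift q μ) := by
  simp [shift]

theorem shift_zero (μ : D.H₀ →ₐ[k] k) : D.shift 0 μ = μ := by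
  simp [shift]

theorem eq_zero_of_shift_eq {p : P₀} {μ : D.H₀ →ₐ[k] k} (h : D.shift p μ = μ) : p = 0 :=
  D.act₀_free _ _ h

theorem shift_injective {p q : P₀} {μ : D.H₀ →ₐ[k] k} (h : D.shift p μ = D.shift q μ) :
    p = q := by
  have : D.shift (-q + p) μ = μ := by
    rw [shift_add, h, ← shift_add, neg_add_cancel, shift_zero]
  have := D.eq_zero_of_shift_eq this
  rwa [neg_add_eq_zero, eq_comm] at this

theorem res_act (θ : P) (χ : D.H →ₐ[k] k) : D.res (D.act θ χ) = D.shift (D.proj θ) (D.res χ) :=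
  D.restrict_act θ χ

theorem proj_mul (θ θ' : P) : D.proj (θ * θ') = D.proj θ + D.proj θ' := by
  apply D.shift_injective (μ := D.res D.zeroG)
  rw [shift_add, ← res_act, ← res_act, ← res_act, map_mul, Equiv.Perm.mul_apply]

theorem act_zeroG_ne {θ : P} (h : D.proj θ ≠ 0) : D.act θ D.zeroG ≠ D.zeroG := by
  intro hc
  have := congrArg D.res hc
  rw [res_act] at this
  exact h (D.eq_zero_of_shift_eq this)

theorem H_le_zero : Subalgebra.toSubmodule D.H ≤ weightSpace D.ad A D.zeroG :=
  fun x hx h => D.ad_on_H h ⟨x, hx⟩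

theorem one_mem_zero : (1 : A) ∈ weightSpace D.ad A D.zeroG :=
  D.H_le_zero (one_mem D.H)

theorem proj_nonneg_of_mem_Bp {θ : P} {b : A} (hb : b ∈ D.Bp) (hθ : b ∈ D.component θ)
    (h0 : b ≠ 0) : D.Nonneg (D.proj θ) := by
  by_contra hc
  refine h0 (eq_zero_of_mem_weightSum (φ := D.ad) (S := {D.act θ D.zeroG})
    (T := {χ | ∃ θ', D.Nonneg (D.proj θ') ∧ D.act θ' D.zeroG = χ}) ?_
    (weightSpace_le_weightSum (Set.mem_singleton _) hθ) ?_)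
  · rw [Set.disjoint_singleton_left]
    rintro ⟨θ', h', he⟩
    rw [D.act_injective he] at h'
    exact hc h'
  · have hb : b ∈ Subalgebra.toSubmodule D.Bp := hb
    rw [D.Bp_weights] at hb
    refine (iSup₂_le fun θ' h' => ?_ : _ ≤ weightSum D.ad A _) hb
    exact inf_le_right.trans (weightSpace_le_weightSum ⟨θ', h', rfl⟩)

theorem proj_nonpos_of_mem_Bm {θ : P} {b : A} (hb : b ∈ D.Bm) (hθ : b ∈ D.component θ)
    (h0 : b ≠ 0) : D.Nonneg (-D.proj θ) := by
  by_contra hc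
  refine h0 (eq_zero_of_mem_weightSum (φ := D.ad) (S := {D.act θ D.zeroG})
    (T := {χ | ∃ θ', D.Nonneg (-D.proj θ') ∧ D.act θ' D.zeroG = χ}) ?_
    (weightSpace_le_weightSum (Set.mem_singleton _) hθ) ?_)
  · rw [Set.disjoint_singleton_left]
    rintro ⟨θ', h', he⟩
    rw [D.act_injective he] at h'
    exact hc h'
  · have hb : b ∈ Subalgebra.toSubmodule D.Bm := hb
    rw [D.Bm_weights] at hb
    refine (iSup₂_le fun θ' h' => ?_ : _ ≤ weightSum D.ad A _) hb
    exact inf_le_right.trans (weightSpace_le_weightSum ⟨θ', D.nonneg_neg_iff.2 h', rfl⟩)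

theorem mem_span_one_of_proj_eq_zero {B : Subalgebra k A}
    (hB : (⨆ (χ : D.H →ₐ[k] k) (_ : D.res χ = D.res D.zeroG),
      Subalgebra.toSubmodule B ⊓ weightSpace D.ad A χ) = Submodule.span k {(1 : A)})
    {θ : P} (hθ : D.proj θ = 0) :
    Subalgebra.toSubmodule B ⊓ D.component θ ≤ Submodule.span k {(1 : A)} := by
  rw [← hB]
  refine le_iSup₂_of_le (D.act θ D.zeroG) ?_ le_rfl
  rw [res_act, hθ, shift_zero]

theorem Bp_le : Subalgebra.toSubmodule D.Bp ≤ Submodule.span k {(1 : A)} ⊔ D.Np := by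
  rw [D.Bp_weights]
  refine iSup₂_le fun θ _ => ?_
  by_cases hθ : D.proj θ = 0
  · exact (D.mem_span_one_of_proj_eq_zero D.Bp_zero hθ).trans le_sup_left
  · exact le_sup_of_le_right (le_iSup₂_of_le (f := fun θ (_ : D.proj θ ≠ 0) =>
      Subalgebra.toSubmodule D.Bp ⊓ D.component θ) θ hθ le_rfl)

theorem Bm_le : Subalgebra.toSubmodule D.Bm ≤ Submodule.span k {(1 : A)} ⊔ D.Nm := by
  rw [D.Bm_weights]
  refine iSup₂_le fun θ _ => ?_
  by_cases hθ : D.proj θ = 0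
  · exact (D.mem_span_one_of_proj_eq_zero D.Bm_zero hθ).trans le_sup_left
  · exact le_sup_of_le_right (le_iSup₂_of_le (f := fun θ (_ : D.proj θ ≠ 0) =>
      Subalgebra.toSubmodule D.Bm ⊓ D.component θ) θ hθ le_rfl)

theorem Np_le_Bp : D.Np ≤ Subalgebra.toSubmodule D.Bp :=
  iSup₂_le fun _ _ => inf_le_left

theorem Np_le_weightSum : D.Np ≤ weightSum D.ad A {D.zeroG}ᶜ :=
  iSup₂_le fun _ hθ => inf_le_right.trans (weightSpace_le_weightSum (D.act_zeroG_ne hθ))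

theorem mem_Np {θ : P} {b : A} (hb : b ∈ D.Bp) (hθ : b ∈ D.component θ) (h : D.proj θ ≠ 0) :
    b ∈ D.Np :=
  le_iSup₂_of_le (f := fun θ (_ : D.proj θ ≠ 0) =>
    Subalgebra.toSubmodule D.Bp ⊓ D.component θ) θ h le_rfl ⟨hb, hθ⟩

theorem one_notMem_Np : (1 : A) ∉ D.Np := by
  intro h
  have h1 : (1 : A) = 0 := eq_zero_of_mem_weightSum (φ := D.ad) (S := {D.zeroG})
    (T := {D.zeroG}ᶜ) disjoint_compl_right (weightSpace_le_weightSum (Set.mem_singleton _) D.one_mem_zero)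
    (D.Np_le_weightSum h)
  have : (1 : D.H) = 0 := Subtype.ext h1
  simpa using congrArg D.zeroG this

/-- The weights of `N₊` are nonzero elements of the cone `ℤ_{≥0} Δ`, in which a sum of nonzero
elements is nonzero. -/
theorem Np_mul_Np : D.Np * D.Np ≤ D.Np := by
  conv_lhs => rw [Np]
  simp only [Submodule.iSup_mul, Submodule.mul_iSup]
  refine iSup₂_le fun θ' hθ' => iSup₂_le fun θ hθ => Submodule.mul_le.2 ?_
  rintro b ⟨hb, hbθ⟩ b' ⟨hb', hbθ'⟩
  rcases eq_or_ne b 0 with rfl | h0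
  · simp
  rcases eq_or_ne b' 0 with rfl | h0'
  · simp
  have hn := D.proj_nonneg_of_mem_Bp hb hbθ h0
  have hn' := D.proj_nonneg_of_mem_Bp hb' hbθ' h0'
  refine D.mem_Np (mul_mem hb hb') (D.weight_mul _ _ _ _ hbθ hbθ') fun hc => hθ ?_
  rw [proj_mul, add_eq_zero_iff_eq_neg] at hc
  exact hn.eq_zero (by rwa [hc, neg_neg])

theorem Bp_mul_Np : Subalgebra.toSubmodule D.Bp * D.Np ≤ D.Np := by
  refine (mul_le_mul_left D.Bp_le _).trans ?_
  rw [Submodule.sup_mul, sup_le_iff]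
  refine ⟨?_, D.Np_mul_Np⟩
  rw [← Submodule.one_eq_span, one_mul]

theorem H_mul_Np_le_weightSum :
    Subalgebra.toSubmodule D.H * D.Np ≤ weightSum D.ad A {D.zeroG}ᶜ := by
  rw [Np]
  simp only [Submodule.mul_iSup]
  refine iSup₂_le fun θ hθ => Submodule.mul_le.2 fun h hh b hb => ?_
  refine weightSpace_le_weightSum (D.act_zeroG_ne hθ) ?_
  have := D.weight_mul 1 θ h b (by rw [act_one]; exact D.H_le_zero hh) hb.2
  rwa [one_mul] at this

/-- `N₊ H ⊆ H N₊`: the product lies in `H B₊ = H + H N₊`, and its `H`-component vanishes because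
of its weight. -/
theorem Np_mul_H :
    D.Np * Subalgebra.toSubmodule D.H ≤ Subalgebra.toSubmodule D.H * D.Np := by
  conv_lhs => rw [Np]
  simp only [Submodule.iSup_mul]
  refine iSup₂_le fun θ hθ => Submodule.mul_le.2 ?_
  rintro b ⟨hb, hbθ⟩ h hh
  have hw : b * h ∈ D.component θ := by
    have := D.weight_mul θ 1 b h hbθ (by rw [act_one]; exact D.H_le_zero hh)
    rwa [mul_one] at this
  have hmem : b * h ∈ Subalgebra.toSubmodule D.H * Subalgebra.toSubmodule D.Bp := by
    apply D.H_Bp_subalgebra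
    refine Submodule.mul_mem_mul ?_ ?_
    · rw [← one_mul b]
      exact Submodule.mul_mem_mul (one_mem D.H) hb
    · rw [← mul_one h]
      exact Submodule.mul_mem_mul hh (one_mem D.Bp)
  have hmem' := mul_le_mul_right D.Bp_le _ hmem
  rw [Submodule.mul_sup, ← Submodule.one_eq_span, mul_one] at hmem'
  obtain ⟨x, hx, y, hy, hxy⟩ := Submodule.mem_sup.1 hmem'
  have hx0 : x = 0 := by
    refine eq_zero_of_mem_weightSum (φ := D.ad) (S := {D.zeroG}) (T := {D.zeroG}ᶜ)
      disjoint_compl_right (weightSpace_le_weightSum (Set.mem_singleton _) (D.H_le_zero hx)) ?_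
    rw [eq_sub_of_add_eq hxy]
    exact sub_mem (weightSpace_le_weightSum (D.act_zeroG_ne hθ) hw) (D.H_mul_Np_le_weightSum hy)
  rw [← hxy, hx0, zero_add]
  exact hy

theorem triangular_induction {p : A → Prop} (a : A)
    (mul : ∀ b ∈ D.Bm, ∀ h ∈ D.H, ∀ b' ∈ D.Bp, p (b * h * b'))
    (add : ∀ x y, p x → p y → p (x + y)) : p a := by
  obtain ⟨t, rfl⟩ := D.triangular.2 a
  have zero : p 0 := by simpa using mul 0 (zero_mem _) 0 (zero_mem _) 0 (zero_mem _)
  induction t using TensorProduct.induction_on with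
  | zero => simpa using zero
  | add x y hx hy => simpa using add _ _ hx hy
  | tmul s b' =>
    induction s using TensorProduct.induction_on with
    | zero => simpa using zero
    | add x y hx hy => rw [TensorProduct.add_tmul, map_add]; exact add _ _ hx hy
    | tmul b h => simpa [tripleMul] using mul b b.2 h h.2 b' b'.2

end Structure

section WeightSmul

variable {k P P₀ : Type*} {A : Type v} {r : ℕ} [Field k] [Ring A] [Algebra k A] [Group P]
  [AddCommGroup P₀]
variable (D : RTA k A P P₀ r)

/-- The rule `A_θ M_χ ⊆ M_{θ * χ}` for modules in an arbitrary universe, obtained from the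
universal case `A / ∑ A (h - χ(h))`. -/
theorem smul_mem_weightSpace_act {R M : Type*} [Ring R] [Algebra k R] (φ : A →ₐ[k] R)
    [AddCommGroup M] [Module k M] [Module R M] [IsScalarTower k R M] {θ : P} {χ : D.H →ₐ[k] k}
    {a : A} {m : M} (ha : a ∈ D.component θ) (hm : m ∈ weightSpace (φ.comp D.H.val) M χ) :
    φ a • m ∈ weightSpace (φ.comp D.H.val) M (D.act θ χ) := by
  intro h
  let I : Submodule A A := Submodule.span A {z | ∃ h : D.H, z = (h : A) - algebraMap k A (χ h)}
  have hI : ∀ z ∈ I, φ z • m = 0 := by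
    intro z hz
    induction hz using Submodule.span_induction with
    | mem z hz =>
      obtain ⟨h, rfl⟩ := hz
      have := hm h
      simp only [AlgHom.comp_apply, Subalgebra.val_apply] at this
      rw [map_sub, sub_smul, this, AlgHom.commutes, algebraMap_smul, sub_self]
    | zero => simp
    | add x y _ _ hx hy => rw [map_add, add_smul, hx, hy, add_zero]
    | smul a x _ hx => rw [smul_eq_mul, map_mul, mul_smul, hx, smul_zero]
  have key := D.weight_smul (A ⧸ I) θ χ a (Submodule.Quotient.mk 1) ha (fun h => by
    rw [← Submodule.Quotient.mk_smul, ← Submodule.Quotient.mk_smul, Submodule.Quotient.eq,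
      smul_eq_mul, smul_eq_mul, mul_one, mul_one]
    exact Submodule.subset_span ⟨h, rfl⟩) h
  simp only [← Submodule.Quotient.mk_smul, Submodule.Quotient.eq, smul_eq_mul, mul_one] at key
  have := hI _ key
  rw [map_sub, sub_smul, sub_eq_zero, map_mul, map_mul, mul_smul, mul_smul, AlgHom.commutes,
    algebraMap_smul] at this
  exact this

end WeightSmul

end RTA

/-! ### Highest weight vectors and the modules that they generate -/

namespace RTA

section HighestWeight

variable {k A P P₀ : Type*} {r : ℕ} [Field k] [Ring A] [Algebra k A] [Group P] [AddCommGroup P₀]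
variable (D : RTA k A P P₀ r)
variable {R M : Type*} [Ring R] [Algebra k R] (φ : A →ₐ[k] R)
  [AddCommGroup M] [Module k M] [Module R M] [IsScalarTower k R M]

/-- The strict order on `G₀`. -/
def lt₀ (μ ν : D.H₀ →ₐ[k] k) : Prop := ∃ p : P₀, D.Nonneg p ∧ p ≠ 0 ∧ D.shift p μ = ν

variable {D} in
theorem lt₀.trans_le {μ ν ρ : D.H₀ →ₐ[k] k} (h : D.lt₀ μ ν) (h' : D.le₀ ν ρ) : D.lt₀ μ ρ := by
  obtain ⟨p, hp, hp0, rfl⟩ := h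
  obtain ⟨q, hq, rfl⟩ := h'
  have hq : D.Nonneg q := hq
  refine ⟨q + p, hq.add hp, fun hc => hp0 ?_, D.shift_add q p μ⟩
  rw [add_eq_zero_iff_eq_neg] at hc
  exact hp.eq_zero (hc ▸ hq)

theorem lt₀_irrefl (μ : D.H₀ →ₐ[k] k) : ¬ D.lt₀ μ μ := by
  rintro ⟨p, _, hp0, h⟩
  exact hp0 (D.eq_zero_of_shift_eq h)

variable {D} in
theorem lt₀.le {μ ν : D.H₀ →ₐ[k] k} (h : D.lt₀ μ ν) : D.le₀ μ ν := by
  obtain ⟨p, hp, _, h⟩ := h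
  exact ⟨p, hp, h⟩

theorem le₀_refl (μ : D.H₀ →ₐ[k] k) : D.le₀ μ μ :=
  ⟨0, fun i => by simp, D.shift_zero μ⟩

theorem le₀_iff {μ ν : D.H₀ →ₐ[k] k} : D.le₀ μ ν ↔ μ = ν ∨ D.lt₀ μ ν := by
  constructor
  · rintro ⟨p, hp, h⟩
    rcases eq_or_ne p 0 with rfl | h0
    · exact Or.inl ((D.shift_zero μ).symm.trans h)
    · exact Or.inr ⟨p, hp, h0, h⟩
  · rintro (rfl | h)
    · exact D.le₀_refl μ
    · exact h.le

/-- The orbit map `a ↦ a m`. -/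
def orbitMap (m : M) : A →ₗ[k] M where
  toFun a := φ a • m
  map_add' a b := by rw [map_add, add_smul]
  map_smul' c a := by rw [map_smul, smul_assoc, RingHom.id_apply]

@[simp] theorem orbitMap_apply (m : M) (a : A) : orbitMap φ m a = φ a • m := rfl

/-- `m` is a highest weight vector of weight `χ` (possibly zero): it has weight `χ` and is
annihilated by `N₊`. -/
structure IsHighest (χ : D.H →ₐ[k] k) (m : M) : Prop where
  weight : m ∈ weightSpace (φ.comp D.H.val) M χ
  annihilated : ∀ n ∈ D.Np, φ n • m = 0

variable {D φ}

theorem IsHighest.smul_H {χ : D.H →ₐ[k] k} {m : M} (hm : D.IsHighest φ χ m) {h : A}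
    (hh : h ∈ D.H) : φ h • m = χ ⟨h, hh⟩ • m :=
  hm.weight ⟨h, hh⟩

theorem IsHighest.exists_Bm {χ : D.H →ₐ[k] k} {m : M} (hm : D.IsHighest φ χ m) (a : A) :
    ∃ b ∈ D.Bm, φ a • m = φ b • m := by
  induction a using D.triangular_induction with
  | mul b hb h hh b' hb' =>
    obtain ⟨x, hx, n, hn, rfl⟩ := Submodule.mem_sup.1 (D.Bp_le hb')
    obtain ⟨c, rfl⟩ := Submodule.mem_span_singleton.1 hx
    refine ⟨(c * χ ⟨h, hh⟩) • b, Subalgebra.smul_mem _ hb _, ?_⟩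
    rw [map_mul, map_mul, mul_smul, mul_smul, map_add, add_smul, hm.annihilated n hn, add_zero,
      map_smul, map_one, smul_assoc, one_smul, algHom_smul_comm (φ h) c m, hm.smul_H hh,
      smul_smul, algHom_smul_comm, map_smul, smul_assoc]
  | add x y hx hy =>
    obtain ⟨b, hb, hx⟩ := hx
    obtain ⟨b', hb', hy⟩ := hy
    exact ⟨b + b', add_mem hb hb', by rw [map_add, map_add, add_smul, add_smul, hx, hy]⟩

theorem IsHighest.range_eq {χ : D.H →ₐ[k] k} {m : M} (hm : D.IsHighest φ χ m) :
    LinearMap.range (orbitMap φ m) = (Subalgebra.toSubmodule D.Bm).map (orbitMap φ m) := by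
  apply le_antisymm
  · rintro _ ⟨a, rfl⟩
    obtain ⟨b, hb, h⟩ := hm.exists_Bm a
    exact ⟨b, hb, h.symm⟩
  · exact LinearMap.map_le_range

theorem IsHighest.smul_Nm {χ : D.H →ₐ[k] k} {m : M} (hm : D.IsHighest φ χ m) {n : A}
    (hn : n ∈ D.Nm) :
    φ n • m ∈ weightSum (φ.comp D.H.val) M {ψ | D.lt₀ (D.res ψ) (D.res χ)} := by
  suffices D.Nm ≤ (weightSum (φ.comp D.H.val) M {ψ | D.lt₀ (D.res ψ) (D.res χ)}).comap
    (orbitMap φ m) from this hn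
  refine iSup₂_le fun θ hθ => ?_
  rintro b ⟨hb, hbθ⟩
  rcases eq_or_ne b 0 with rfl | h0
  · exact zero_mem _
  refine weightSpace_le_weightSum (χ := D.act θ χ) ?_
    (D.smul_mem_weightSpace_act φ hbθ hm.weight)
  refine ⟨-D.proj θ, D.proj_nonpos_of_mem_Bm hb hbθ h0, neg_ne_zero.2 hθ, ?_⟩
  rw [res_act, ← shift_add, neg_add_cancel, shift_zero]

/-- The module generated by a highest weight vector `m` consists of the multiples of `m` and of
vectors of strictly lower weights. -/
theorem IsHighest.range_le {χ : D.H →ₐ[k] k} {m : M} (hm : D.IsHighest φ χ m) :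
    LinearMap.range (orbitMap φ m) ≤ Submodule.span k {m} ⊔
      weightSum (φ.comp D.H.val) M {ψ | D.lt₀ (D.res ψ) (D.res χ)} := by
  rw [hm.range_eq, Submodule.map_le_iff_le_comap]
  refine D.Bm_le.trans (sup_le ?_ ?_)
  · rw [Submodule.span_singleton_le_iff_mem]
    refine Submodule.mem_sup_left ?_
    simp
  · exact fun n hn => Submodule.mem_sup_right (hm.smul_Nm hn)

theorem IsHighest.range_le_weightSum {χ : D.H →ₐ[k] k} {m : M} (hm : D.IsHighest φ χ m) :
    LinearMap.range (orbitMap φ m) ≤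
      weightSum (φ.comp D.H.val) M {ψ | D.le₀ (D.res ψ) (D.res χ)} := by
  refine hm.range_le.trans (sup_le ?_ (weightSum_mono fun ψ hψ => hψ.le))
  rw [Submodule.span_singleton_le_iff_mem]
  exact weightSpace_le_weightSum (D.le₀_refl _) hm.weight

variable (D φ)

theorem finiteDimensional_Bm_component {θ : P} (hθ : D.Nonneg (-D.proj θ)) :
    FiniteDimensional k ↥(Subalgebra.toSubmodule D.Bm ⊓ D.component θ) := by
  have : FiniteDimensional k ↥(⨆ (χ : D.H →ₐ[k] k)
      (_ : D.res χ = D.shift (D.proj θ) (D.res D.zeroG)),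
      Subalgebra.toSubmodule D.Bm ⊓ weightSpace D.ad A χ) :=
    D.Bm_finite (D.proj θ) (D.nonneg_neg_iff.1 hθ)
  exact Submodule.finiteDimensional_of_le (le_iSup₂_of_le
    (f := fun χ (_ : D.res χ = D.shift (D.proj θ) (D.res D.zeroG)) =>
      Subalgebra.toSubmodule D.Bm ⊓ weightSpace D.ad A χ) _ (D.res_act θ D.zeroG) le_rfl)

/-- The component `(B₊)_p` for `p ∈ P₀`. -/
def BpComp (p : P₀) : Submodule k A :=
  ⨆ (χ : D.H →ₐ[k] k) (_ : D.res χ = D.shift p (D.res D.zeroG)),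
    Subalgebra.toSubmodule D.Bp ⊓ weightSpace D.ad A χ

theorem Bp_inf_component_le (θ : P) :
    Subalgebra.toSubmodule D.Bp ⊓ D.component θ ≤ D.BpComp (D.proj θ) :=
  le_iSup₂_of_le (f := fun χ (_ : D.res χ = D.shift (D.proj θ) (D.res D.zeroG)) =>
    Subalgebra.toSubmodule D.Bp ⊓ weightSpace D.ad A χ) _ (D.res_act θ D.zeroG) le_rfl

theorem finite_nonneg_interval (q : P₀) : {p : P₀ | D.Nonneg p ∧ D.Nonneg (q - p)}.Finite := by
  have : (Set.Icc (0 : Fin r → ℤ) (D.Δ.equivFun q)).Finite := Set.finite_Icc _ _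
  refine (this.preimage D.Δ.equivFun.injective.injOn).subset ?_
  rintro p ⟨hp, hq⟩
  refine ⟨fun i => by simpa using hp i, fun i => ?_⟩
  have := hq i
  simp only [map_sub, Finsupp.sub_apply] at this
  simpa using this

theorem finite_nonneg_le (μ ν : D.H₀ →ₐ[k] k) :
    {p : P₀ | D.Nonneg p ∧ D.le₀ (D.shift p μ) ν}.Finite := by
  by_cases h : ∃ q, D.shift q μ = ν
  · obtain ⟨q, rfl⟩ := h
    refine (D.finite_nonneg_interval q).subset ?_
    rintro p ⟨hp, s, hs, h⟩
    have h : D.shift s (D.shift p μ) = D.shift q μ := h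
    rw [← shift_add] at h
    rw [← D.shift_injective h]
    refine ⟨hp, ?_⟩
    rw [add_sub_cancel_right]
    exact hs
  · convert Set.finite_empty
    ext p
    simp only [Set.mem_ofPred_eq, Set.mem_empty_iff_false, iff_false, not_and]
    rintro _ ⟨s, _, hs⟩
    exact h ⟨s + p, by rw [shift_add]; exact hs⟩

variable {D φ}
variable {ι : Type*} {χ : ι → D.H →ₐ[k] k} {v : ι → M}

theorem top_le_weightSum (hv : ∀ i, D.IsHighest φ (χ i) (v i))
    (hgen : ⨆ i, LinearMap.range (orbitMap φ (v i)) = ⊤) :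
    weightSum (φ.comp D.H.val) M {ψ | ∃ i, D.le₀ (D.res ψ) (D.res (χ i))} = ⊤ := by
  rw [eq_top_iff, ← hgen]
  exact iSup_le fun i => (hv i).range_le_weightSum.trans (weightSum_mono fun ψ hψ => ⟨i, hψ⟩)

variable [Finite ι]

theorem finiteDimensional_weightSpace (hv : ∀ i, D.IsHighest φ (χ i) (v i))
    (hgen : ⨆ i, LinearMap.range (orbitMap φ (v i)) = ⊤) (ψ : D.H →ₐ[k] k) :
    FiniteDimensional k (weightSpace (φ.comp D.H.val) M ψ) := by
  -- the part of `B₋ v_i` of weight `ψ`; at most one `θ` contributes to it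
  let T : ι → Submodule k M := fun i =>
    (⨆ (θ : P) (_ : D.act θ (χ i) = ψ ∧ D.Nonneg (-D.proj θ)),
      Subalgebra.toSubmodule D.Bm ⊓ D.component θ).map (orbitMap φ (v i))
  have hTfin : ∀ i, FiniteDimensional k (T i) := by
    intro i
    by_cases h : ∃ θ, D.act θ (χ i) = ψ ∧ D.Nonneg (-D.proj θ)
    · obtain ⟨θ, hθ, hn⟩ := h
      have := D.finiteDimensional_Bm_component hn
      refine Submodule.finiteDimensional_of_le (S₂ := (Subalgebra.toSubmodule D.Bm ⊓
        D.component θ).map (orbitMap φ (v i))) (Submodule.map_mono ?_)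
      refine iSup₂_le fun θ' h' => ?_
      rw [D.act_injective (h'.1.trans hθ.symm)]
    · have : T i = ⊥ := by
        rw [eq_bot_iff, Submodule.map_le_iff_le_comap]
        exact iSup₂_le fun θ h' => (h ⟨θ, h'⟩).elim
      rw [this]
      infer_instance
  have hTle : ⨆ i, T i ≤ weightSpace (φ.comp D.H.val) M ψ := by
    refine iSup_le fun i => ?_
    rw [Submodule.map_le_iff_le_comap]
    refine iSup₂_le fun θ hθ => ?_
    rintro b ⟨_, hb⟩
    rw [← hθ.1]
    exact D.smul_mem_weightSpace_act φ hb (hv i).weight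
  have htop : (⊤ : Submodule k M) ≤ (⨆ i, T i) ⊔ weightSum (φ.comp D.H.val) M {ψ}ᶜ := by
    rw [← hgen]
    refine iSup_le fun i => ?_
    rw [(hv i).range_eq, Submodule.map_le_iff_le_comap, D.Bm_weights]
    refine iSup₂_le fun θ hθ => ?_
    by_cases h : D.act θ (χ i) = ψ
    · rw [← Submodule.map_le_iff_le_comap]
      refine le_sup_of_le_left (le_iSup_of_le i (Submodule.map_mono ?_))
      exact le_iSup₂_of_le (f := fun θ (_ : D.act θ (χ i) = ψ ∧ D.Nonneg (-D.proj θ)) =>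
        Subalgebra.toSubmodule D.Bm ⊓ D.component θ) θ ⟨h, D.nonneg_neg_iff.2 hθ⟩ le_rfl
    · rintro b ⟨_, hb⟩
      exact Submodule.mem_sup_right (weightSpace_le_weightSum h
        (D.smul_mem_weightSpace_act φ hb (hv i).weight))
  refine Submodule.finiteDimensional_of_le (S₂ := ⨆ i, T i) fun m hm => ?_
  obtain ⟨t, ht, t', ht', rfl⟩ := Submodule.mem_sup.1 (htop (Submodule.mem_top (x := m)))
  have : t' ∈ weightSpace (φ.comp D.H.val) M ψ := by
    have := sub_mem hm (hTle ht)
    rwa [add_sub_cancel_left] at this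
  rw [eq_zero_of_mem_weightSum disjoint_compl_right
    (weightSpace_le_weightSum (Set.mem_singleton ψ) this) ht', add_zero]
  exact ht

theorem finiteDimensional_Bp_orbit_of_weight (hv : ∀ i, D.IsHighest φ (χ i) (v i))
    (hgen : ⨆ i, LinearMap.range (orbitMap φ (v i)) = ⊤) {ψ : D.H →ₐ[k] k} {m : M}
    (hm : m ∈ weightSpace (φ.comp D.H.val) M ψ) :
    FiniteDimensional k ((Subalgebra.toSubmodule D.Bp).map (orbitMap φ m)) := by
  let F : Set P₀ := ⋃ i, {p : P₀ | D.Nonneg p ∧ D.le₀ (D.shift p (D.res ψ)) (D.res (χ i))}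
  have hF : F.Finite := Set.finite_iUnion fun i => D.finite_nonneg_le _ _
  have : Finite F := hF
  have hfin : ∀ p : F, FiniteDimensional k (D.BpComp p) := by
    rintro ⟨p, hp⟩
    obtain ⟨i, hp, _⟩ := Set.mem_iUnion.1 hp
    exact D.Bp_finite p hp
  refine Submodule.finiteDimensional_of_le (S₂ := ⨆ p : F, (D.BpComp p).map (orbitMap φ m)) ?_
  rw [Submodule.map_le_iff_le_comap, D.Bp_weights]
  refine iSup₂_le fun θ hθ => ?_
  rintro b hb
  by_cases h0 : φ b • m = 0
  · rw [Submodule.mem_comap, orbitMap_apply, h0]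
    exact zero_mem _
  have hw := D.smul_mem_weightSpace_act φ hb.2 hm
  -- the weight of a nonzero vector lies below some `χ i`
  have hmem : ∃ i, D.le₀ (D.res (D.act θ ψ)) (D.res (χ i)) := by
    by_contra hc
    refine h0 (eq_zero_of_mem_weightSum (S := {D.act θ ψ}) (Set.disjoint_singleton_left.2 ?_)
      (weightSpace_le_weightSum (Set.mem_singleton _) hw)
      (top_le_weightSum hv hgen ▸ Submodule.mem_top))
    exact hc
  obtain ⟨i, hi⟩ := hmem
  rw [res_act] at hi
  exact Submodule.mem_iSup_of_mem ⟨D.proj θ, Set.mem_iUnion.2 ⟨i, hθ, hi⟩⟩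
    ⟨b, D.Bp_inf_component_le θ hb, rfl⟩

theorem finiteDimensional_Bp_orbit (hv : ∀ i, D.IsHighest φ (χ i) (v i))
    (hgen : ⨆ i, LinearMap.range (orbitMap φ (v i)) = ⊤) (m : M) :
    FiniteDimensional k ((Subalgebra.toSubmodule D.Bp).map (orbitMap φ m)) := by
  have hm : m ∈ ⨆ ψ, weightSpace (φ.comp D.H.val) M ψ := by
    have : m ∈ weightSum (φ.comp D.H.val) M {ψ | ∃ i, D.le₀ (D.res ψ) (D.res (χ i))} :=
      top_le_weightSum hv hgen ▸ Submodule.mem_top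
    exact weightSum_le (fun ψ _ => le_iSup _ ψ) this
  refine Submodule.iSup_induction _ (motive := fun m => FiniteDimensional k
    ((Subalgebra.toSubmodule D.Bp).map (orbitMap φ m))) hm
    (fun ψ m hm => finiteDimensional_Bp_orbit_of_weight hv hgen hm) ?_ ?_
  · have : (Subalgebra.toSubmodule D.Bp).map (orbitMap φ (0 : M)) = ⊥ := by
      rw [eq_bot_iff]
      rintro _ ⟨a, _, rfl⟩
      simp
    rw [this]
    infer_instance
  · intro x y _ _
    refine Submodule.finiteDimensional_of_le
      (S₂ := (Subalgebra.toSubmodule D.Bp).map (orbitMap φ x) ⊔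
        (Subalgebra.toSubmodule D.Bp).map (orbitMap φ y)) ?_
    rintro _ ⟨b, hb, rfl⟩
    rw [orbitMap_apply, smul_add]
    exact add_mem (Submodule.mem_sup_left ⟨b, hb, rfl⟩) (Submodule.mem_sup_right ⟨b, hb, rfl⟩)

/-- A module generated over `A` by finitely many highest weight vectors lies in `𝒪`. -/
theorem inO_of_isHighest (hv : ∀ i, D.IsHighest φ (χ i) (v i))
    (hgen : ⨆ i, LinearMap.range (orbitMap φ (v i)) = ⊤) : D.InO φ M where
  finitelyGenerated := by
    have := Fintype.ofFinite ι
    classical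
    refine ⟨⟨Finset.univ.image v, ?_⟩⟩
    rw [eq_top_iff]
    have : (⊤ : Submodule k M) ≤
        (Submodule.span R (↑(Finset.univ.image v) : Set M)).restrictScalars k := by
      rw [← hgen]
      refine iSup_le fun i => ?_
      rintro _ ⟨a, rfl⟩
      exact Submodule.smul_mem _ _ (Submodule.subset_span (by simp))
    exact fun m _ => this Submodule.mem_top
  semisimple := by
    rw [IsHSemisimple, eq_top_iff, ← top_le_weightSum hv hgen]
    exact weightSum_le fun ψ _ => le_iSup _ ψ
  finite_weightSpace := finiteDimensional_weightSpace hv hgen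
  locallyFinite m := by
    have := finiteDimensional_Bp_orbit hv hgen m
    refine Submodule.finiteDimensional_of_le
      (S₂ := (Subalgebra.toSubmodule D.Bp).map (orbitMap φ m)) ?_
    rw [Submodule.span_le]
    rintro _ ⟨b, hb, rfl⟩
    exact ⟨b, hb, rfl⟩

end HighestWeight

end RTA

/-! ### Linear independence in Verma modules -/

namespace RTA

section Functional

variable {k A P P₀ : Type*} {r : ℕ} [Field k] [Ring A] [Algebra k A] [Group P] [AddCommGroup P₀]
variable (D : RTA k A P P₀ r)

theorem exists_augmentation : ∃ ε : A →ₗ[k] k, ε 1 = 1 ∧ ∀ n ∈ D.Np, ε n = 0 := by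
  obtain ⟨f, hf, h0⟩ := Submodule.exists_dual_map_eq_bot_of_notMem D.one_notMem_Np inferInstance
  refine ⟨(f 1)⁻¹ • f, by simp [inv_mul_cancel₀ hf], fun n hn => ?_⟩
  have : f n ∈ D.Np.map f := ⟨n, hn, rfl⟩
  rw [h0, Submodule.mem_bot] at this
  simp [this]

/-- For a representation `E` of `H`, the map `b h b' ⊗ e ↦ ε(b') b ⊗ h e` realizes the quotient of
`A ⊗ E` by the relations `a n ⊗ e = 0` (`n ∈ N₊`) and `a h ⊗ e = a ⊗ h e` as `B₋ ⊗ E`. -/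
theorem exists_induced {E : Type*} [AddCommGroup E] [Module k E] (ρ : D.H →ₐ[k] Module.End k E) :
    ∃ q : A →ₗ[k] E →ₗ[k] A ⊗[k] E, (∀ b ∈ D.Bm, ∀ e, q b e = b ⊗ₜ e) ∧
      (∀ a, ∀ n ∈ D.Np, ∀ e, q (a * n) e = 0) ∧ ∀ a (h : D.H) e, q (a * h) e = q a (ρ h e) := by
  obtain ⟨ε, hε1, hε⟩ := D.exists_augmentation
  let T : D.Bm →ₗ[k] D.H →ₗ[k] D.Bp →ₗ[k] E →ₗ[k] A ⊗[k] E := LinearMap.mk₂ k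
    (fun b h => (ε.comp D.Bp.val.toLinearMap).smulRight
      ((TensorProduct.mk k A E (b : A)).comp (ρ h)))
    (fun b b' h => by ext; simp)
    (fun c b h => by
      ext b' e
      simp only [LinearMap.smulRight_apply, LinearMap.smul_apply, LinearMap.comp_apply,
        TensorProduct.mk_apply, SetLike.val_smul, ← TensorProduct.smul_tmul']
      rw [smul_comm])
    (fun b h h' => by ext; simp [TensorProduct.tmul_add])
    (fun c b h => by
      ext b' e
      simp only [LinearMap.smulRight_apply, LinearMap.smul_apply, LinearMap.comp_apply,
        TensorProduct.mk_apply, map_smul]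
      rw [smul_comm])
  let q : A →ₗ[k] E →ₗ[k] A ⊗[k] E := (TensorProduct.lift (TensorProduct.lift T)).comp
    (LinearEquiv.ofBijective _ D.triangular).symm.toLinearMap
  have hq : ∀ b (hb : b ∈ D.Bm) h (hh : h ∈ D.H) b' (_ : b' ∈ D.Bp) e,
      q (b * h * b') e = ε b' • b ⊗ₜ[k] (ρ ⟨h, hh⟩ e) := by
    intro b hb h hh b' hb' e
    have : (LinearEquiv.ofBijective _ D.triangular).symm (b * h * b') =
        ((⟨b, hb⟩ : D.Bm) ⊗ₜ[k] (⟨h, hh⟩ : D.H)) ⊗ₜ[k] (⟨b', hb'⟩ : D.Bp) := by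
      rw [LinearEquiv.symm_apply_eq]
      simp [tripleMul]
    simp only [q, LinearMap.comp_apply, LinearEquiv.coe_coe, this]
    simp [T]
  have hHN : ∀ b ∈ D.Bm, ∀ x ∈ Subalgebra.toSubmodule D.H * D.Np, ∀ e, q (b * x) e = 0 := by
    intro b hb x hx e
    induction hx using Submodule.mul_induction_on' with
    | mem_mul_mem h hh n hn =>
      rw [← mul_assoc, hq b hb h hh n (D.Np_le_Bp hn), hε n hn, zero_smul]
    | add x _ y _ hx hy => rw [mul_add, map_add, LinearMap.add_apply, hx, hy, add_zero]
  refine ⟨q, fun b hb e => ?_, fun a n hn e => ?_, fun a h e => ?_⟩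
  · have := hq b hb 1 (one_mem _) 1 (one_mem _) e
    rw [mul_one, mul_one, hε1, one_smul] at this
    rw [this]
    congr 1
    exact congrArg (fun f : Module.End k E => f e) (map_one ρ)
  · induction a using D.triangular_induction with
    | mul b hb h hh b' hb' =>
      rw [mul_assoc, mul_assoc]
      exact hHN b hb _ (Submodule.mul_mem_mul hh
        (D.Bp_mul_Np (Submodule.mul_mem_mul hb' hn))) e
    | add x y hx hy => rw [add_mul, map_add, LinearMap.add_apply, hx, hy, add_zero]
  · induction a using D.triangular_induction with
    | mul b hb g hg b' hb' =>
      obtain ⟨x, hx, n, hn, rfl⟩ := Submodule.mem_sup.1 (D.Bp_le hb')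
      obtain ⟨c, rfl⟩ := Submodule.mem_span_singleton.1 hx
      have h1 : b * g * (c • 1 + n) * (h : A) = c • (b * (g * h) * 1) + b * (g * (n * h)) := by
        simp only [mul_add, add_mul, Algebra.mul_smul_comm, Algebra.smul_mul_assoc, mul_one,
          mul_assoc]
      have h2 : g * (n * (h : A)) ∈ Subalgebra.toSubmodule D.H * D.Np := by
        have := D.Np_mul_H (Submodule.mul_mem_mul hn h.2)
        have := Submodule.mul_mem_mul (M := Subalgebra.toSubmodule D.H) hg this
        rwa [← mul_assoc, Subalgebra.isIdempotentElem_toSubmodule] at this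
      rw [h1, map_add, LinearMap.add_apply, hHN b hb _ h2, add_zero, map_smul,
        LinearMap.smul_apply, hq b hb _ (mul_mem hg h.2) 1 (one_mem _), hq b hb g hg _ hb',
        hε1, one_smul, map_add, map_smul, hε1, hε n hn, add_zero, smul_eq_mul, mul_one]
      congr 2
      exact congrArg (fun f : Module.End k E => f e) (map_mul ρ ⟨g, hg⟩ h)
    | add x y hx hy =>
      rw [add_mul, map_add, map_add, LinearMap.add_apply, hx, hy, LinearMap.add_apply]

end Functional

/-! ### Modules induced from `H ⋊ Γ` -/

section SkewModules

variable {k A P P₀ : Type*} {r : ℕ} [Field k] [Ring A] [Algebra k A] [Group P] [AddCommGroup P₀]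
variable (D : RTA k A P P₀ r) (Γ : Type*) [Group Γ] [MulSemiringAction Γ A] [SMulCommClass Γ k A]

/-- The element of `H ⋊ Γ` given by a group element. -/
noncomputable def ofHΓ (γ : Γ) : D.HΓ Γ :=
  ⟨SkewMonoidAlgebra.of A Γ γ, Algebra.subset_adjoin (Or.inr ⟨γ, rfl⟩)⟩

@[simp] theorem coe_ofHΓ (γ : Γ) : (D.ofHΓ Γ γ : SkewMonoidAlgebra A Γ) =
    SkewMonoidAlgebra.of A Γ γ := rfl

@[simp] theorem coe_toHΓ (h : D.H) : (D.toHΓ Γ h : SkewMonoidAlgebra A Γ) =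
    toSkew k A Γ h := rfl

theorem ofHΓ_mul (γ γ' : Γ) : D.ofHΓ Γ (γ * γ') = D.ofHΓ Γ γ * D.ofHΓ Γ γ' :=
  Subtype.ext (map_mul _ γ γ')

theorem ofHΓ_one : D.ofHΓ Γ 1 = 1 := Subtype.ext (map_one (SkewMonoidAlgebra.of A Γ))

theorem toSkew_apply (a : A) : toSkew k A Γ a = SkewMonoidAlgebra.single 1 a := rfl

theorem single_eq (γ : Γ) (a : A) :
    SkewMonoidAlgebra.single γ a = toSkew k A Γ a * SkewMonoidAlgebra.of A Γ γ := by
  rw [toSkew_apply, SkewMonoidAlgebra.of_apply, SkewMonoidAlgebra.single_mul_single]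
  simp

theorem of_mul_toSkew (γ : Γ) (a : A) :
    SkewMonoidAlgebra.of A Γ γ * toSkew k A Γ a =
      toSkew k A Γ (γ • a) * SkewMonoidAlgebra.of A Γ γ := by
  rw [← single_eq, toSkew_apply, SkewMonoidAlgebra.of_apply, SkewMonoidAlgebra.single_mul_single]
  simp

variable {Γ} {E : Type*} [AddCommGroup E] [Module k E] [Module (D.HΓ Γ) E]
  [IsScalarTower k (D.HΓ Γ) E]

/-- A subspace stable under `H` and `Γ` is stable under `H ⋊ Γ`. -/
theorem HΓ_smul_mem {N : Submodule k E} (hH : ∀ h : D.H, ∀ e ∈ N, D.toHΓ Γ h • e ∈ N)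
    (hG : ∀ γ : Γ, ∀ e ∈ N, D.ofHΓ Γ γ • e ∈ N) (s : D.HΓ Γ) : ∀ e ∈ N, s • e ∈ N := by
  obtain ⟨s, hs⟩ := s
  induction hs using Algebra.adjoin_induction with
  | mem s hs =>
    rcases hs with ⟨h, hh, rfl⟩ | ⟨γ, rfl⟩
    · exact hH ⟨h, hh⟩
    · exact hG γ
  | algebraMap c =>
    intro e he
    have : (algebraMap k (D.HΓ Γ) c) • e ∈ N := by
      rw [algebraMap_smul]
      exact N.smul_mem c he
    exact this
  | add x y hx hy h1 h2 =>
    intro e he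
    have : ((⟨x, hx⟩ : D.HΓ Γ) + ⟨y, hy⟩) • e ∈ N := by
      rw [add_smul]
      exact add_mem (h1 e he) (h2 e he)
    exact this
  | mul x y hx hy h1 h2 =>
    intro e he
    have : ((⟨x, hx⟩ : D.HΓ Γ) * ⟨y, hy⟩) • e ∈ N := by
      rw [mul_smul]
      exact h1 _ (h2 e he)
    exact this

theorem ofHΓ_mul_toHΓ (hΓ : D.SkewCompatible Γ) (γ : Γ) (h : D.H) :
    D.ofHΓ Γ γ * D.toHΓ Γ h = D.toHΓ Γ ⟨γ • (h : A), hΓ.smul_H γ h h.2⟩ * D.ofHΓ Γ γ :=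
  Subtype.ext (of_mul_toSkew (k := k) Γ γ (h : A))

/-- The kernel of `(A ⋊ Γ) ⊗ E → Z(E)` is small: there is a linear map on `(A ⋊ Γ) ⊗ E` which
kills the relations and restricts to the map `B₋ ⊗ E → A ⊗ E`. -/
theorem exists_induced_skew (hΓ : D.SkewCompatible Γ) :
    ∃ g : SkewMonoidAlgebra A Γ ⊗[k] E →ₗ[k] A ⊗[k] E, (∀ z ∈ D.vermaRel Γ E, g z = 0) ∧
      ∀ b ∈ D.Bm, ∀ e : E, g (toSkew k A Γ b ⊗ₜ e) = b ⊗ₜ e := by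
  obtain ⟨q, hq1, hqn, hqh⟩ := D.exists_induced
    ((Algebra.lsmul k k E).comp (D.toHΓ Γ) : D.H →ₐ[k] Module.End k E)
  let σ : Γ → E →ₗ[k] E := fun γ => Algebra.lsmul k k E (D.ofHΓ Γ γ)
  let g : SkewMonoidAlgebra A Γ ⊗[k] E →ₗ[k] A ⊗[k] E := TensorProduct.lift
    ((Finsupp.lsum k fun γ => (LinearMap.lcomp k (A ⊗[k] E) (σ γ)).comp q).comp
      (SkewMonoidAlgebra.coeffLinearEquiv (S := k) (k := A) (G := Γ)).toLinearMap)
  have hg : ∀ γ a e, g (SkewMonoidAlgebra.single γ a ⊗ₜ e) = q a (D.ofHΓ Γ γ • e) := by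
    intro γ a e
    simp [g, σ, SkewMonoidAlgebra.coeffLinearEquiv]
  have hrel : ∀ s (hs : s ∈ D.HΓ Γ) (s' : SkewMonoidAlgebra A Γ) (e : E),
      g ((s' * s) ⊗ₜ e) = g (s' ⊗ₜ ((⟨s, hs⟩ : D.HΓ Γ) • e)) := by
    intro s hs
    induction hs using Algebra.adjoin_induction with
    | mem s hs =>
      intro s' e
      induction s' using SkewMonoidAlgebra.induction_on with
      | zero => simp
      | add x y hx hy => rw [add_mul, TensorProduct.add_tmul, TensorProduct.add_tmul, map_add,
          map_add, hx, hy]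
      | single γ a =>
      rcases hs with ⟨h, hh, rfl⟩ | ⟨γ', rfl⟩
      · change _ = g (SkewMonoidAlgebra.single γ a ⊗ₜ[k] (D.toHΓ Γ ⟨h, hh⟩ • e))
        rw [toSkew_apply, SkewMonoidAlgebra.single_mul_single, mul_one, hg, hg,
          hqh a ⟨γ • h, hΓ.smul_H γ h hh⟩]
        change q a (D.toHΓ Γ ⟨γ • h, hΓ.smul_H γ h hh⟩ • D.ofHΓ Γ γ • e) =
          q a (D.ofHΓ Γ γ • D.toHΓ Γ ⟨h, hh⟩ • e)
        rw [← mul_smul, ← mul_smul, D.ofHΓ_mul_toHΓ hΓ]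
      · change _ = g (SkewMonoidAlgebra.single γ a ⊗ₜ[k] (D.ofHΓ Γ γ' • e))
        rw [SkewMonoidAlgebra.of_apply, SkewMonoidAlgebra.single_mul_single, smul_one, mul_one,
          hg, hg, ofHΓ_mul, mul_smul]
    | algebraMap c =>
      intro s' e
      change _ = g (s' ⊗ₜ[k] (algebraMap k (D.HΓ Γ) c • e))
      rw [algebraMap_smul, ← TensorProduct.smul_tmul, Algebra.smul_def, Algebra.commutes]
    | add x y hx hy h1 h2 =>
      intro s' e
      change _ = g (s' ⊗ₜ[k] (((⟨x, hx⟩ : D.HΓ Γ) + ⟨y, hy⟩) • e))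
      rw [mul_add, TensorProduct.add_tmul, map_add, h1, h2, add_smul, TensorProduct.tmul_add,
        map_add]
    | mul x y hx hy h1 h2 =>
      intro s' e
      change _ = g (s' ⊗ₜ[k] (((⟨x, hx⟩ : D.HΓ Γ) * ⟨y, hy⟩) • e))
      rw [← mul_assoc, h2, h1, mul_smul]
  refine ⟨g, fun z hz => ?_, fun b hb e => ?_⟩
  · suffices ∀ s : SkewMonoidAlgebra A Γ, g (s • z) = 0 by simpa using this 1
    induction hz using Submodule.span_induction with
    | mem z hz =>
      intro s
      rcases hz with ⟨t, e, rfl⟩ | ⟨n, hn, e, rfl⟩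
      · rw [smul_sub, TensorProduct.smul_tmul', TensorProduct.smul_tmul', smul_eq_mul,
          smul_eq_mul, mul_one, map_sub, hrel t t.2, sub_self]
      · rw [TensorProduct.smul_tmul', smul_eq_mul]
        induction s using SkewMonoidAlgebra.induction_on with
        | zero => simp
        | add x y hx hy => rw [add_mul, TensorProduct.add_tmul, map_add, hx, hy, add_zero]
        | single γ a =>
          rw [toSkew_apply, SkewMonoidAlgebra.single_mul_single, hg,
            hqn a _ (hΓ.smul_Np γ n hn)]
    | zero => simp
    | add x y _ _ hx hy => intro s; rw [smul_add, map_add, hx, hy, add_zero]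
    | smul s' x _ hx => intro s; rw [smul_smul, hx]
  · rw [toSkew_apply, hg, hq1 b hb, ofHΓ_one, one_smul]

end SkewModules

end RTA

/-! ### Unique maximal submodules -/

section Top

variable {k H R M : Type*} [Field k] [Ring H] [Algebra k H] [Ring R] [Algebra k R]
  [AddCommGroup M] [Module k M] [Module R M] [IsScalarTower k R M]

/-- `E` is a top component of `M`: it generates `M`, every submodule of `M` contains `E` or meets
it trivially, and its weights, in `O`, are separated from those of a complement, in `L`. -/
structure IsTopComponent (φ : H →ₐ[k] R) (E : Submodule k M) (O L : Set (H →ₐ[k] k)) : Prop where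
  disjoint : Disjoint O L
  le_weightSum : E ≤ weightSum φ M O
  top_le : ⊤ ≤ E ⊔ weightSum φ M L
  ne_bot : E ≠ ⊥
  eq_top : ∀ N : Submodule R M, (∀ e ∈ E, e ∈ N) → N = ⊤
  simple : ∀ N : Submodule R M, (∀ e ∈ E, e ∈ N → e = 0) ∨ ∀ e ∈ E, e ∈ N

namespace IsTopComponent

variable {φ : H →ₐ[k] R} {E : Submodule k M} {O L : Set (H →ₐ[k] k)}
  (hE : IsTopComponent φ E O L)
include hE

theorem mem_weightSum_of_ne_top {N : Submodule R M} (hN : N ≠ ⊤) {m : M} (hm : m ∈ N) :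
    m ∈ weightSum φ M L := by
  obtain ⟨e, he, l, hl, rfl⟩ := Submodule.mem_sup.1 (hE.top_le (Submodule.mem_top (x := m)))
  have heN : e ∈ N.restrictScalars k :=
    mem_of_add_mem hE.disjoint (N := N.restrictScalars k) (fun h m hm => N.smul_mem _ hm)
      (hE.le_weightSum he) hl hm
  have he0 : e = 0 := by
    rcases hE.simple N with h | h
    · exact h e he heN
    · exact (hN (hE.eq_top N h)).elim
  rwa [he0, zero_add]

theorem mem_weightSum_of_mem_sumProper {m : M} (hm : m ∈ RTA.sumProper R M) :
    m ∈ weightSum φ M L := by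
  rw [RTA.sumProper, sSup_eq_iSup'] at hm
  refine Submodule.iSup_induction _ (motive := fun m => m ∈ weightSum φ M L) hm
    (fun N m hm => hE.mem_weightSum_of_ne_top N.2 hm) (zero_mem _) fun x y hx hy => add_mem hx hy

theorem eq_zero_of_mem_sumProper {e : M} (he : e ∈ E) (h : e ∈ RTA.sumProper R M) : e = 0 :=
  eq_zero_of_mem_weightSum hE.disjoint (hE.le_weightSum he) (hE.mem_weightSum_of_mem_sumProper h)

theorem ne_top_of_le {N : Submodule R M} (hN : ∀ m ∈ N, m ∈ weightSum φ M L) : N ≠ ⊤ := by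
  rintro rfl
  refine hE.ne_bot ((Submodule.eq_bot_iff _).2 fun e he => ?_)
  exact eq_zero_of_mem_weightSum hE.disjoint (hE.le_weightSum he) (hN e Submodule.mem_top)

theorem le_sumProper {N : Submodule R M} (hN : ∀ m ∈ N, m ∈ weightSum φ M L) :
    N ≤ RTA.sumProper R M :=
  le_sSup (hE.ne_top_of_le hN)

theorem isCoatom_iff (N : Submodule R M) : IsCoatom N ↔ N = RTA.sumProper R M := by
  have hne : RTA.sumProper R M ≠ ⊤ := hE.ne_top_of_le fun m => hE.mem_weightSum_of_mem_sumProper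
  constructor
  · intro h
    by_contra hN
    exact hne (h.2 _ (lt_of_le_of_ne (le_sSup h.1) hN))
  · rintro rfl
    refine ⟨hne, fun N hN => ?_⟩
    by_contra hc
    exact absurd (le_sSup hc) (not_le_of_gt hN)

end IsTopComponent

end Top

/-! ### Verma modules over the triangular algebra -/

namespace RTA

section VermaA

variable {k A P P₀ : Type*} {r : ℕ} [Field k] [Ring A] [Algebra k A] [Group P] [AddCommGroup P₀]
variable {D : RTA k A P P₀ r}

theorem IsHighest.map {R M N : Type*} [Ring R] [Algebra k R] {φ : A →ₐ[k] R}
    [AddCommGroup M] [Module k M] [Module R M] [IsScalarTower k R M]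
    [AddCommGroup N] [Module k N] [Module R N] [IsScalarTower k R N]
    {χ : D.H →ₐ[k] k} {m : M} (hm : D.IsHighest φ χ m) (f : M →ₗ[R] N) :
    D.IsHighest φ χ (f m) where
  weight h := by rw [← map_smul, hm.weight h, LinearMap.map_smul_of_tower]
  annihilated n hn := by rw [← map_smul, hm.annihilated n hn, map_zero]

theorem iSup_range_orbitMap_map {R M N : Type*} [Ring R] [Algebra k R] {φ : A →ₐ[k] R}
    [AddCommGroup M] [Module k M] [Module R M] [IsScalarTower k R M]
    [AddCommGroup N] [Module k N] [Module R N] [IsScalarTower k R N] {ι : Type*} {v : ι → M}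
    (hv : ⨆ i, LinearMap.range (orbitMap φ (v i)) = ⊤) (f : M →ₗ[R] N)
    (hf : Function.Surjective f) :
    ⨆ i, LinearMap.range (orbitMap φ (f (v i))) = ⊤ := by
  have h : ∀ i, LinearMap.range (orbitMap φ (f (v i))) =
      (LinearMap.range (orbitMap φ (v i))).map (f.restrictScalars k) := by
    intro i
    rw [← LinearMap.range_comp]
    congr 1
    ext a
    simp
  simp only [h]
  rw [← Submodule.map_iSup, hv, Submodule.map_top, LinearMap.range_eq_top]
  exact hf

theorem IsHighest.smul_vermaIdeal {R M : Type*} [Ring R] [Algebra k R] {φ : A →ₐ[k] R}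
    [AddCommGroup M] [Module k M] [Module R M] [IsScalarTower k R M]
    {χ : D.H →ₐ[k] k} {m : M} (hm : D.IsHighest φ χ m) {a : A} (ha : a ∈ D.vermaIdeal χ) :
    φ a • m = 0 := by
  induction ha using Submodule.span_induction with
  | mem a ha =>
    rcases ha with ha | ⟨h, rfl⟩
    · exact hm.annihilated a ha
    · rw [map_sub, sub_smul, hm.smul_H h.2, AlgHom.commutes, algebraMap_smul, sub_self]
  | zero => rw [map_zero, zero_smul]
  | add x y _ _ hx hy => rw [map_add, add_smul, hx, hy, add_zero]
  | smul a x _ hx => rw [smul_eq_mul, map_mul, mul_smul, hx, smul_zero]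

variable (D)

/-- The canonical generator of the Verma module `Z_A(χ)`. -/
def vermaVector (χ : D.H →ₐ[k] k) : D.ZA χ := Submodule.Quotient.mk 1

theorem smul_vermaVector (χ : D.H →ₐ[k] k) (a : A) :
    a • D.vermaVector χ = Submodule.Quotient.mk a := by
  rw [vermaVector, ← Submodule.Quotient.mk_smul, smul_eq_mul, mul_one]

theorem smul_vermaVector_eq_zero {χ : D.H →ₐ[k] k} {a : A} :
    a • D.vermaVector χ = 0 ↔ a ∈ D.vermaIdeal χ := by
  rw [smul_vermaVector, Submodule.Quotient.mk_eq_zero]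

theorem isHighest_vermaVector (χ : D.H →ₐ[k] k) :
    D.IsHighest (AlgHom.id k A) χ (D.vermaVector χ) where
  weight h := by
    change (h : A) • D.vermaVector χ = χ h • D.vermaVector χ
    rw [← algebraMap_smul A (χ h), ← sub_eq_zero, ← sub_smul, smul_vermaVector_eq_zero]
    exact Submodule.subset_span (Or.inr ⟨h, rfl⟩)
  annihilated n hn := by
    change n • D.vermaVector χ = 0
    rw [smul_vermaVector_eq_zero]
    exact Submodule.subset_span (Or.inl hn)

theorem range_orbitMap_vermaVector (χ : D.H →ₐ[k] k) :
    LinearMap.range (orbitMap (AlgHom.id k A) (D.vermaVector χ)) = ⊤ := by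
  rw [LinearMap.range_eq_top]
  intro z
  obtain ⟨a, rfl⟩ := Submodule.Quotient.mk_surjective _ z
  exact ⟨a, D.smul_vermaVector χ a⟩

/-- Every element of `A` agrees with an element of `B₋` on highest weight vectors. -/
theorem exists_sub_mem_vermaIdeal (χ : D.H →ₐ[k] k) (a : A) :
    ∃ b ∈ D.Bm, a - b ∈ D.vermaIdeal χ := by
  obtain ⟨b, hb, h⟩ := (D.isHighest_vermaVector χ).exists_Bm a
  refine ⟨b, hb, ?_⟩
  rw [← smul_vermaVector_eq_zero, sub_smul, sub_eq_zero]
  exact h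

theorem eq_zero_of_mem_vermaIdeal {χ : D.H →ₐ[k] k} {b : A} (hb : b ∈ D.Bm)
    (h : b ∈ D.vermaIdeal χ) : b = 0 := by
  obtain ⟨q, hq, hqn, hqh⟩ := D.exists_induced ((Algebra.lmul k k).comp χ)
  have : ∀ a ∈ D.vermaIdeal χ, q a 1 = 0 := by
    intro a ha
    suffices ∀ a', q (a' * a) 1 = 0 by simpa using this 1
    induction ha using Submodule.span_induction with
    | mem a ha =>
      intro a'
      rcases ha with ha | ⟨h, rfl⟩
      · exact hqn a' a ha 1
      · rw [mul_sub, map_sub, LinearMap.sub_apply, hqh, ← Algebra.commutes, ← Algebra.smul_def,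
          map_smul, LinearMap.smul_apply, sub_eq_zero, ← map_smul]
        simp
    | zero => simp
    | add x y _ _ hx hy => intro a'; rw [mul_add, map_add, LinearMap.add_apply, hx, hy, add_zero]
    | smul s x _ hx => intro a'; rw [smul_eq_mul, ← mul_assoc, hx]
  have h1 := this b h
  rw [hq b hb] at h1
  have := congrArg (TensorProduct.rid k A) h1
  simpa using this

theorem vermaVector_ne_zero (χ : D.H →ₐ[k] k) : D.vermaVector χ ≠ 0 := by
  intro h
  rw [← one_smul A (D.vermaVector χ), smul_vermaVector_eq_zero] at h
  exact D.one_notMem_Np (D.eq_zero_of_mem_vermaIdeal (one_mem _) h ▸ zero_mem _)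

theorem isTopComponent_ZA (χ : D.H →ₐ[k] k) :
    IsTopComponent ((AlgHom.id k A).comp D.H.val) (Submodule.span k {D.vermaVector χ})
      {χ} {ψ | D.lt₀ (D.res ψ) (D.res χ)} where
  disjoint := Set.disjoint_singleton_left.2 (D.lt₀_irrefl _)
  le_weightSum := (Submodule.span_singleton_le_iff_mem _ _).2
    (weightSpace_le_weightSum (Set.mem_singleton χ) (D.isHighest_vermaVector χ).weight)
  top_le := by
    rw [← D.range_orbitMap_vermaVector χ]
    exact (D.isHighest_vermaVector χ).range_le
  ne_bot := by
    rw [Ne, Submodule.span_singleton_eq_bot]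
    exact D.vermaVector_ne_zero χ
  eq_top N hN := by
    rw [eq_top_iff]
    rintro z -
    obtain ⟨a, rfl⟩ := Submodule.Quotient.mk_surjective _ z
    rw [← smul_vermaVector]
    exact N.smul_mem a (hN _ (Submodule.mem_span_singleton_self _))
  simple N := by
    by_cases h : D.vermaVector χ ∈ N
    · refine Or.inr fun e he => ?_
      obtain ⟨c, rfl⟩ := Submodule.mem_span_singleton.1 he
      exact N.smul_of_tower_mem c h
    · refine Or.inl fun e he heN => ?_
      obtain ⟨c, rfl⟩ := Submodule.mem_span_singleton.1 he
      by_contra hc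
      have hc : c ≠ 0 := fun h0 => hc (by rw [h0, zero_smul])
      have := N.smul_of_tower_mem c⁻¹ heN
      rw [smul_smul, inv_mul_cancel₀ hc, one_smul] at this
      exact h this

theorem inO_ZA (χ : D.H →ₐ[k] k) : D.InO (AlgHom.id k A) (D.ZA χ) :=
  inO_of_isHighest (ι := Unit) (fun _ => D.isHighest_vermaVector χ)
    (by rw [iSup_const, range_orbitMap_vermaVector])

theorem inO_VA (χ : D.H →ₐ[k] k) : D.InO (AlgHom.id k A) (D.VA χ) :=
  inO_of_isHighest (ι := Unit) (φ := AlgHom.id k A)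
    (fun _ => (D.isHighest_vermaVector χ).map (sumProper A (D.ZA χ)).mkQ)
    (iSup_range_orbitMap_map (by rw [iSup_const, range_orbitMap_vermaVector]) _
      (Submodule.mkQ_surjective _))

variable {D}

/-- An element of `A` which maps the generator of `Z_A(χ)` into the maximal submodule maps every
highest weight vector of weight `χ` to a sum of vectors of strictly lower weights. -/
theorem IsHighest.smul_mem_of_mem_sumProper {R M : Type*} [Ring R] [Algebra k R] {φ : A →ₐ[k] R}
    [AddCommGroup M] [Module k M] [Module R M] [IsScalarTower k R M]
    {χ : D.H →ₐ[k] k} {m : M} (hm : D.IsHighest φ χ m) {a : A}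
    (ha : a • D.vermaVector χ ∈ sumProper A (D.ZA χ)) :
    φ a • m ∈ weightSum (φ.comp D.H.val) M {ψ | D.lt₀ (D.res ψ) (D.res χ)} := by
  have hv := D.isHighest_vermaVector χ
  have htop := D.isTopComponent_ZA χ
  have hlow := htop.mem_weightSum_of_mem_sumProper ha
  obtain ⟨b, hb, hab⟩ := D.exists_sub_mem_vermaIdeal χ a
  obtain ⟨x, hx, n, hn, rfl⟩ := Submodule.mem_sup.1 (D.Bm_le hb)
  obtain ⟨c, rfl⟩ := Submodule.mem_span_singleton.1 hx
  have h1 := D.smul_vermaVector_eq_zero.2 hab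
  rw [sub_smul, sub_eq_zero, add_smul, smul_assoc, one_smul] at h1
  have hc : c • D.vermaVector χ = 0 := by
    refine eq_zero_of_mem_weightSum htop.disjoint
      (htop.le_weightSum (Submodule.mem_span_singleton.2 ⟨c, rfl⟩)) ?_
    rw [eq_sub_of_add_eq h1.symm]
    exact sub_mem hlow (hv.smul_Nm hn)
  have hc : c = 0 := (smul_eq_zero.1 hc).resolve_right (D.vermaVector_ne_zero χ)
  rw [hc, zero_smul, zero_add] at hab
  have h2 := hm.smul_vermaIdeal hab
  rw [map_sub, sub_smul, sub_eq_zero] at h2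
  rw [h2]
  exact hm.smul_Nm hn

end VermaA

end RTA

/-! ### The action of the finite group on weights -/

namespace RTA

section GroupAction

variable {k A P P₀ : Type*} {r : ℕ} [Field k] [Ring A] [Algebra k A] [Group P] [AddCommGroup P₀]
variable {D : RTA k A P P₀ r} {Γ : Type*} [Group Γ] [MulSemiringAction Γ A] [SMulCommClass Γ k A]

theorem dualAct_apply (B : Subalgebra k A) (hB : ∀ γ : Γ, ∀ x ∈ B, γ • x ∈ B) (γ : Γ)
    (χ : B →ₐ[k] k) (b : B) : dualAct B hB γ χ b = χ ⟨γ⁻¹ • (b : A), hB γ⁻¹ b b.2⟩ := rfl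

theorem dualAct_mul (B : Subalgebra k A) (hB : ∀ γ : Γ, ∀ x ∈ B, γ • x ∈ B) (γ γ' : Γ)
    (χ : B →ₐ[k] k) : dualAct B hB (γ * γ') χ = dualAct B hB γ (dualAct B hB γ' χ) := by
  ext b
  simp only [dualAct_apply, mul_inv_rev, mul_smul]

theorem dualAct_one (B : Subalgebra k A) (hB : ∀ γ : Γ, ∀ x ∈ B, γ • x ∈ B)
    (χ : B →ₐ[k] k) : dualAct B hB (1 : Γ) χ = χ := by
  ext b
  simp only [dualAct_apply, inv_one, one_smul]

theorem res_dualAct (hΓ : D.SkewCompatible Γ) (γ : Γ) (χ : D.H →ₐ[k] k) :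
    D.res (dualAct D.H hΓ.smul_H γ χ) = dualAct D.H₀ hΓ.smul_H₀ γ (D.res χ) := rfl

theorem lt₀_dualAct (hΓ : D.SkewCompatible Γ) (γ : Γ) {μ ν : D.H₀ →ₐ[k] k} (h : D.lt₀ μ ν) :
    D.lt₀ (dualAct D.H₀ hΓ.smul_H₀ γ μ) (dualAct D.H₀ hΓ.smul_H₀ γ ν) := by
  rcases D.le₀_iff.1 (hΓ.order γ μ ν h.le) with he | hlt
  · have := congrArg (dualAct D.H₀ hΓ.smul_H₀ γ⁻¹) he
    rw [← dualAct_mul, ← dualAct_mul, inv_mul_cancel, dualAct_one, dualAct_one] at this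
    exact (D.lt₀_irrefl _ (this ▸ h)).elim
  · exact hlt

/-- The `Γ`-orbits on `G₀` are antichains: an element `δ` with `δ μ < μ` would have infinite
order. -/
theorem not_lt₀_dualAct_self (hΓ : D.SkewCompatible Γ) (δ : Γ) (μ : D.H₀ →ₐ[k] k) :
    ¬ D.lt₀ (dualAct D.H₀ hΓ.smul_H₀ δ μ) μ := by
  intro h
  have hpow : ∀ n : ℕ, D.lt₀ (dualAct D.H₀ hΓ.smul_H₀ (δ ^ (n + 1)) μ) μ := by
    intro n
    induction n with
    | zero => simpa using h
    | succ n ih =>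
      rw [pow_succ', dualAct_mul]
      exact (lt₀_dualAct hΓ δ ih).trans_le h.le
  have := hΓ.finite
  have h1 := hpow (orderOf δ - 1)
  rw [Nat.sub_add_cancel (orderOf_pos δ), pow_orderOf_eq_one, dualAct_one] at h1
  exact D.lt₀_irrefl _ h1

/-- The orbit of a weight under `Γ`. -/
def orbitWeights (hΓ : D.SkewCompatible Γ) (χ : D.H →ₐ[k] k) : Set (D.H →ₐ[k] k) :=
  Set.range fun γ : Γ => dualAct D.H hΓ.smul_H γ χ

/-- The weights whose restriction to `H₀` is strictly smaller than that of some weight in the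
`Γ`-orbit of `χ`. -/
def lowerWeights (hΓ : D.SkewCompatible Γ) (χ : D.H →ₐ[k] k) : Set (D.H →ₐ[k] k) :=
  {ψ | ∃ γ : Γ, D.lt₀ (D.res ψ) (D.res (dualAct D.H hΓ.smul_H γ χ))}

theorem disjoint_orbit_lower (hΓ : D.SkewCompatible Γ) (χ : D.H →ₐ[k] k) :
    Disjoint (orbitWeights hΓ χ) (lowerWeights hΓ χ) := by
  rw [Set.disjoint_left]
  rintro _ ⟨γ', rfl⟩ ⟨γ, h⟩
  rw [res_dualAct hΓ, res_dualAct hΓ] at h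
  have := lt₀_dualAct hΓ γ⁻¹ h
  rw [← dualAct_mul, ← dualAct_mul, inv_mul_cancel, dualAct_one] at this
  exact not_lt₀_dualAct_self hΓ _ _ this

section SkewModule

theorem of_smul_toSkew_smul {M : Type*} [AddCommGroup M] [Module (SkewMonoidAlgebra A Γ) M]
    (γ : Γ) (a : A) (m : M) :
    SkewMonoidAlgebra.of A Γ γ • toSkew k A Γ a • m =
      toSkew k A Γ (γ • a) • SkewMonoidAlgebra.of A Γ γ • m := by
  rw [← mul_smul, of_mul_toSkew (k := k), mul_smul]

variable {M : Type*} [AddCommGroup M] [Module k M] [Module (SkewMonoidAlgebra A Γ) M]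
  [IsScalarTower k (SkewMonoidAlgebra A Γ) M]

theorem of_smul_mem_weightSpace (hΓ : D.SkewCompatible Γ) (γ : Γ) {χ : D.H →ₐ[k] k} {m : M}
    (hm : m ∈ weightSpace ((toSkew k A Γ).comp D.H.val) M χ) :
    SkewMonoidAlgebra.of A Γ γ • m ∈
      weightSpace ((toSkew k A Γ).comp D.H.val) M (dualAct D.H hΓ.smul_H γ χ) := by
  intro h
  have h1 : toSkew k A Γ (γ⁻¹ • (h : A)) • m = _ := hm ⟨γ⁻¹ • (h : A), hΓ.smul_H γ⁻¹ h h.2⟩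
  have h2 := of_smul_toSkew_smul (k := k) γ (γ⁻¹ • (h : A)) m
  rw [smul_inv_smul, h1, algHom_smul_comm] at h2
  exact h2.symm

theorem of_smul_mem_lower (hΓ : D.SkewCompatible Γ) (γ : Γ) {χ : D.H →ₐ[k] k} {m : M}
    (hm : m ∈ weightSum ((toSkew k A Γ).comp D.H.val) M {ψ | D.lt₀ (D.res ψ) (D.res χ)}) :
    SkewMonoidAlgebra.of A Γ γ • m ∈
      weightSum ((toSkew k A Γ).comp D.H.val) M (lowerWeights hΓ χ) := by
  suffices weightSum ((toSkew k A Γ).comp D.H.val) M {ψ | D.lt₀ (D.res ψ) (D.res χ)} ≤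
      (weightSum ((toSkew k A Γ).comp D.H.val) M (lowerWeights hΓ χ)).comap
        (Algebra.lsmul k k M (SkewMonoidAlgebra.of A Γ γ)) from this hm
  refine weightSum_le fun ψ hψ m hm => ?_
  exact weightSpace_le_weightSum (S := lowerWeights hΓ χ) (χ := dualAct D.H hΓ.smul_H γ ψ) ⟨γ, lt₀_dualAct hΓ γ hψ⟩
    (of_smul_mem_weightSpace hΓ γ hm)

theorem IsHighest.of_smul (hΓ : D.SkewCompatible Γ) (γ : Γ) {χ : D.H →ₐ[k] k} {m : M}
    (hm : D.IsHighest (toSkew k A Γ) χ m) :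
    D.IsHighest (toSkew k A Γ) (dualAct D.H hΓ.smul_H γ χ) (SkewMonoidAlgebra.of A Γ γ • m) where
  weight := of_smul_mem_weightSpace hΓ γ hm.weight
  annihilated n hn := by
    have := of_smul_toSkew_smul (k := k) γ (γ⁻¹ • n) m
    rw [hm.annihilated _ (hΓ.smul_Np γ⁻¹ n hn), smul_zero, smul_inv_smul] at this
    exact this.symm

theorem ofHΓ_smul_mem_weightSpace {E : Type*} [AddCommGroup E] [Module k E] [Module (D.HΓ Γ) E]
    [IsScalarTower k (D.HΓ Γ) E] (hΓ : D.SkewCompatible Γ) (γ : Γ) {χ : D.H →ₐ[k] k} {e : E}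
    (he : e ∈ weightSpace (D.toHΓ Γ) E χ) :
    D.ofHΓ Γ γ • e ∈ weightSpace (D.toHΓ Γ) E (dualAct D.H hΓ.smul_H γ χ) := by
  intro h
  have h1 := he ⟨γ⁻¹ • (h : A), hΓ.smul_H γ⁻¹ h h.2⟩
  have h2 := D.ofHΓ_mul_toHΓ hΓ γ ⟨γ⁻¹ • (h : A), hΓ.smul_H γ⁻¹ h h.2⟩
  simp only [smul_inv_smul] at h2
  rw [← mul_smul, ← h2, mul_smul, h1, algHom_smul_comm]
  rfl

/-- A simple `H ⋊ Γ`-module is spanned by the translates of any nonzero weight vector. -/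
theorem span_range_ofHΓ_smul {E : Type*} [AddCommGroup E] [Module k E] [Module (D.HΓ Γ) E]
    [IsScalarTower k (D.HΓ Γ) E] [IsSimpleModule (D.HΓ Γ) E] (hΓ : D.SkewCompatible Γ)
    {χ : D.H →ₐ[k] k} {e : E} (he : e ∈ weightSpace (D.toHΓ Γ) E χ) (h0 : e ≠ 0) :
    Submodule.span k (Set.range fun γ : Γ => D.ofHΓ Γ γ • e) = ⊤ := by
  set N := Submodule.span k (Set.range fun γ : Γ => D.ofHΓ Γ γ • e) with hN
  have hstable : ∀ s : D.HΓ Γ, ∀ x ∈ N, s • x ∈ N := by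
    refine D.HΓ_smul_mem (fun h => ?_) (fun γ => ?_)
    · change N ≤ N.comap (Algebra.lsmul k k E (D.toHΓ Γ h))
      conv_lhs => rw [hN]
      rw [Submodule.span_le]
      rintro _ ⟨γ', rfl⟩
      change D.toHΓ Γ h • D.ofHΓ Γ γ' • e ∈ N
      rw [ofHΓ_smul_mem_weightSpace hΓ γ' he h]
      exact N.smul_mem _ (Submodule.subset_span ⟨γ', rfl⟩)
    · change N ≤ N.comap (Algebra.lsmul k k E (D.ofHΓ Γ γ))
      conv_lhs => rw [hN]
      rw [Submodule.span_le]
      rintro _ ⟨γ', rfl⟩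
      change D.ofHΓ Γ γ • D.ofHΓ Γ γ' • e ∈ N
      rw [← mul_smul, ← ofHΓ_mul]
      exact Submodule.subset_span ⟨γ * γ', rfl⟩
  let N' : Submodule (D.HΓ Γ) E := { N with smul_mem' := fun s x hx => hstable s x hx }
  have heN : e ∈ N := Submodule.subset_span ⟨1, by simp only [ofHΓ_one, one_smul]⟩
  have : N' = ⊤ := (eq_bot_or_eq_top N').resolve_left fun hb => h0 <| by
    have : e ∈ N' := heN
    rwa [hb, Submodule.mem_bot] at this
  rw [eq_top_iff]
  intro x _
  have : x ∈ N' := this ▸ Submodule.mem_top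
  exact this

end SkewModule

/-! ### Verma modules over the skew group ring -/

section Verma

variable (x : RTA.X.{w} D Γ)

/-- The canonical map `M_x → Z(x)`, `e ↦ 1 ⊗ e`. -/
noncomputable def vermaTop : x.carrier →ₗ[k] Z x :=
  ((D.vermaRel Γ x.carrier).mkQ.restrictScalars k).comp
    (TensorProduct.mk k (SkewMonoidAlgebra A Γ) x.carrier 1)

theorem smul_vermaTop (s : SkewMonoidAlgebra A Γ) (e : x.carrier) :
    s • vermaTop x e = Submodule.Quotient.mk (s ⊗ₜ[k] e) := by
  change s • Submodule.Quotient.mk ((1 : SkewMonoidAlgebra A Γ) ⊗ₜ[k] e) = _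
  rw [← Submodule.Quotient.mk_smul, TensorProduct.smul_tmul', smul_eq_mul, mul_one]

theorem coe_smul_vermaTop (s : D.HΓ Γ) (e : x.carrier) :
    (s : SkewMonoidAlgebra A Γ) • vermaTop x e = vermaTop x (s • e) := by
  rw [← one_smul (SkewMonoidAlgebra A Γ) (vermaTop x (s • e)), smul_vermaTop, smul_vermaTop,
    Submodule.Quotient.eq]
  exact Submodule.subset_span (Or.inl ⟨s, e, rfl⟩)

theorem toSkew_smul_vermaTop {n : A} (hn : n ∈ D.Np) (e : x.carrier) :
    toSkew k A Γ n • vermaTop x e = 0 := by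
  rw [smul_vermaTop, Submodule.Quotient.mk_eq_zero]
  exact Submodule.subset_span (Or.inr ⟨n, hn, e, rfl⟩)

variable {x}

theorem isHighest_vermaTop {χ : D.H →ₐ[k] k} {e : x.carrier}
    (he : e ∈ weightSpace (D.toHΓ Γ) x.carrier χ) :
    D.IsHighest (toSkew k A Γ) χ (vermaTop x e) where
  weight h := by
    have := coe_smul_vermaTop x (D.toHΓ Γ h) e
    rw [he h, map_smul] at this
    exact this
  annihilated n hn := toSkew_smul_vermaTop x hn e

/-- The Verma module `Z_A(χ)` embeds into `Z(x)` for every weight `χ` of `M_x`. -/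
theorem toSkew_smul_vermaTop_eq_zero (hΓ : D.SkewCompatible Γ) {χ : D.H →ₐ[k] k} {e : x.carrier}
    (he : e ∈ weightSpace (D.toHΓ Γ) x.carrier χ) (h0 : e ≠ 0) {a : A} :
    toSkew k A Γ a • vermaTop x e = 0 ↔ a ∈ D.vermaIdeal χ := by
  refine ⟨fun h => ?_, (isHighest_vermaTop he).smul_vermaIdeal⟩
  obtain ⟨b, hb, hab⟩ := D.exists_sub_mem_vermaIdeal χ a
  have h1 := (isHighest_vermaTop he).smul_vermaIdeal hab
  rw [map_sub, sub_smul, h, zero_sub, neg_eq_zero, smul_vermaTop,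
    Submodule.Quotient.mk_eq_zero] at h1
  obtain ⟨g, hg, hgb⟩ := D.exists_induced_skew (E := x.carrier) hΓ
  have h2 := hg _ h1
  rw [hgb b hb] at h2
  have hb0 : b = 0 := by
    obtain ⟨f, hf⟩ := Module.Projective.exists_dual_eq_one k h0
    have h3 := congrArg (fun t => TensorProduct.rid k A (f.lTensor A t)) h2
    simpa [hf] using h3
  rwa [hb0, sub_zero] at hab

theorem vermaTop_ne_zero (hΓ : D.SkewCompatible Γ) {χ : D.H →ₐ[k] k} {e : x.carrier}
    (he : e ∈ weightSpace (D.toHΓ Γ) x.carrier χ) (h0 : e ≠ 0) : vermaTop x e ≠ 0 := by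
  intro h
  have h1 : toSkew k A Γ 1 • vermaTop x e = 0 := by rw [h, smul_zero]
  rw [toSkew_smul_vermaTop_eq_zero hΓ he h0] at h1
  exact D.one_notMem_Np (D.eq_zero_of_mem_vermaIdeal (one_mem _) h1 ▸ zero_mem _)

theorem X.IsWeight.exists_ne_zero {χ : D.H →ₐ[k] k} (h : x.IsWeight χ) :
    ∃ e ∈ weightSpace (D.toHΓ Γ) x.carrier χ, e ≠ 0 :=
  Submodule.exists_mem_ne_zero_of_ne_bot h

theorem X.exists_isWeight (x : RTA.X.{w} D Γ) : ∃ χ, x.IsWeight χ := by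
  by_contra! h
  have := x.simple
  have hs := x.semisimple
  simp only [X.IsWeight, not_not] at h
  simp only [IsHSemisimple, h, iSup_bot] at hs
  have := IsSimpleModule.nontrivial (D.HΓ Γ) x.carrier
  exact bot_ne_top hs

variable {χ : D.H →ₐ[k] k} {e : x.carrier}

theorem iSup_range_orbitMap_vermaTop (hΓ : D.SkewCompatible Γ)
    (he : e ∈ weightSpace (D.toHΓ Γ) x.carrier χ) (h0 : e ≠ 0) :
    ⨆ γ : Γ, LinearMap.range (orbitMap (toSkew k A Γ) (vermaTop x (D.ofHΓ Γ γ • e))) = ⊤ := by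
  set N := ⨆ γ : Γ, LinearMap.range (orbitMap (toSkew k A Γ) (vermaTop x (D.ofHΓ Γ γ • e)))
  have := x.simple
  have h1 : ∀ (a : A) (e' : x.carrier), toSkew k A Γ a • vermaTop x e' ∈ N := by
    intro a e'
    have : (⊤ : Submodule k x.carrier) ≤ N.comap
        ((Algebra.lsmul k k (Z x) (toSkew k A Γ a)).comp (vermaTop x)) := by
      rw [← span_range_ofHΓ_smul hΓ he h0, Submodule.span_le]
      rintro _ ⟨γ, rfl⟩
      exact Submodule.mem_iSup_of_mem γ ⟨a, rfl⟩
    exact this Submodule.mem_top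
  rw [eq_top_iff]
  rintro z -
  obtain ⟨z, rfl⟩ := Submodule.Quotient.mk_surjective _ z
  induction z using TensorProduct.induction_on with
  | zero => exact zero_mem _
  | add y z hy hz => rw [Submodule.Quotient.mk_add]; exact add_mem hy hz
  | tmul s e' =>
    rw [← smul_vermaTop]
    induction s using SkewMonoidAlgebra.induction_on with
    | zero => rw [zero_smul]; exact zero_mem _
    | add y z hy hz => rw [add_smul]; exact add_mem hy hz
    | single γ a =>
      rw [single_eq (k := k), mul_smul, ← D.coe_ofHΓ, coe_smul_vermaTop]
      exact h1 a _

theorem isTopComponent_Z (hΓ : D.SkewCompatible Γ)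
    (he : e ∈ weightSpace (D.toHΓ Γ) x.carrier χ) (h0 : e ≠ 0) :
    IsTopComponent ((toSkew k A Γ).comp D.H.val) (LinearMap.range (vermaTop x))
      (orbitWeights hΓ χ) (lowerWeights hΓ χ) where
  disjoint := disjoint_orbit_lower hΓ χ
  le_weightSum := by
    have := x.simple
    rw [LinearMap.range_eq_map, ← span_range_ofHΓ_smul hΓ he h0, Submodule.map_le_iff_le_comap,
      Submodule.span_le]
    rintro _ ⟨γ, rfl⟩
    exact weightSpace_le_weightSum (S := orbitWeights hΓ χ) ⟨γ, rfl⟩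
      (isHighest_vermaTop (ofHΓ_smul_mem_weightSpace hΓ γ he)).weight
  top_le := by
    rw [← iSup_range_orbitMap_vermaTop hΓ he h0]
    refine iSup_le fun γ =>
      (isHighest_vermaTop (ofHΓ_smul_mem_weightSpace hΓ γ he)).range_le.trans ?_
    refine sup_le_sup ?_ (weightSum_mono fun ψ hψ => ⟨γ, hψ⟩)
    rw [Submodule.span_singleton_le_iff_mem]
    exact ⟨_, rfl⟩
  ne_bot := by
    intro h
    refine vermaTop_ne_zero hΓ he h0 ?_
    have : vermaTop x e ∈ LinearMap.range (vermaTop x) := ⟨e, rfl⟩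
    rwa [h, Submodule.mem_bot] at this
  eq_top N hN := by
    rw [eq_top_iff]
    have : (⊤ : Submodule k (Z x)) ≤ N.restrictScalars k := by
      rw [← iSup_range_orbitMap_vermaTop hΓ he h0]
      refine iSup_le fun γ => ?_
      rintro _ ⟨a, rfl⟩
      exact N.smul_mem _ (hN _ ⟨_, rfl⟩)
    exact fun z _ => this Submodule.mem_top
  simple N := by
    let N' : Submodule (D.HΓ Γ) x.carrier :=
      { (N.restrictScalars k).comap (vermaTop x) with
        smul_mem' := fun s e (he : vermaTop x e ∈ N) => by
          change vermaTop x (s • e) ∈ N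
          rw [← coe_smul_vermaTop]
          exact N.smul_mem _ he }
    have := x.simple
    rcases eq_bot_or_eq_top N' with h | h
    · left
      rintro _ ⟨e, rfl⟩ heN
      have : e ∈ N' := heN
      rw [h, Submodule.mem_bot] at this
      rw [this, map_zero]
    · right
      rintro _ ⟨e, rfl⟩
      have : e ∈ N' := h ▸ Submodule.mem_top
      exact this

theorem inO_Z (hΓ : D.SkewCompatible Γ) (x : RTA.X.{w} D Γ) : D.InO (toSkew k A Γ) (Z x) := by
  obtain ⟨χ, hχ⟩ := x.exists_isWeight
  obtain ⟨e, he, h0⟩ := hχ.exists_ne_zero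
  have := hΓ.finite
  exact inO_of_isHighest (fun γ => isHighest_vermaTop (ofHΓ_smul_mem_weightSpace hΓ γ he))
    (iSup_range_orbitMap_vermaTop hΓ he h0)

theorem inO_V (hΓ : D.SkewCompatible Γ) (x : RTA.X.{w} D Γ) : D.InO (toSkew k A Γ) (V x) := by
  obtain ⟨χ, hχ⟩ := x.exists_isWeight
  obtain ⟨e, he, h0⟩ := hχ.exists_ne_zero
  have := hΓ.finite
  exact inO_of_isHighest
    (fun γ => (isHighest_vermaTop (ofHΓ_smul_mem_weightSpace hΓ γ he)).map
      (sumProper (SkewMonoidAlgebra A Γ) (Z x)).mkQ)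
    (iSup_range_orbitMap_map (iSup_range_orbitMap_vermaTop hΓ he h0) _
      (Submodule.mkQ_surjective _))

theorem isCoatom_iff_Z (hΓ : D.SkewCompatible Γ) (x : RTA.X.{w} D Γ)
    (N : Submodule (SkewMonoidAlgebra A Γ) (Z x)) :
    IsCoatom N ↔ N = sumProper (SkewMonoidAlgebra A Γ) (Z x) := by
  obtain ⟨χ, hχ⟩ := x.exists_isWeight
  obtain ⟨e, he, h0⟩ := hχ.exists_ne_zero
  exact (isTopComponent_Z hΓ he h0).isCoatom_iff N

end Verma

end GroupAction

end RTA

/-! ### Simple modules in the category `𝒪` -/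

theorem IsHSemisimple.of_injective {k H R M N : Type*} [Field k] [Ring H] [Algebra k H] [Ring R]
    [Algebra k R] [AddCommGroup M] [Module k M] [Module R M] [IsScalarTower k R M]
    [AddCommGroup N] [Module k N] [Module R N] [IsScalarTower k R N] {φ : H →ₐ[k] R}
    (hM : IsHSemisimple φ M) (f : N →ₗ[R] M) (hf : Function.Injective f) : IsHSemisimple φ N := by
  rw [isHSemisimple_iff] at hM
  rw [IsHSemisimple, eq_top_iff]
  intro n _
  have h1 : f n ∈ ⨆ χ ∈ Set.univ, LinearMap.range (f.restrictScalars k) ⊓ weightSpace φ M χ := by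
    refine mem_iSup_inf_weightSpace ?_ ⟨n, rfl⟩ (hM ▸ Submodule.mem_top)
    rintro h _ ⟨n, rfl⟩
    exact ⟨φ h • n, map_smul f _ _⟩
  have h2 : ⨆ χ ∈ Set.univ, LinearMap.range (f.restrictScalars k) ⊓ weightSpace φ M χ ≤
      (⨆ χ, weightSpace φ N χ).map (f.restrictScalars k) := by
    refine iSup₂_le fun χ _ => ?_
    rintro _ ⟨⟨n, rfl⟩, hn⟩
    refine ⟨n, le_iSup (fun χ => weightSpace φ N χ) χ fun h => hf ?_, rfl⟩
    rw [map_smul, LinearMap.map_smul_of_tower]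
    exact hn h
  obtain ⟨n', hn', h3⟩ := h2 h1
  rwa [← hf h3]

namespace RTA

section ExistsHighest

variable {k A P P₀ : Type*} {r : ℕ} [Field k] [Ring A] [Algebra k A] [Group P] [AddCommGroup P₀]
variable {D : RTA k A P P₀ r}
variable {R M : Type*} [Ring R] [Algebra k R] {φ : A →ₐ[k] R}
  [AddCommGroup M] [Module k M] [Module R M] [IsScalarTower k R M]

theorem Np_smul_mem_weightSum {ψ : D.H →ₐ[k] k} {m : M}
    (hm : m ∈ weightSpace (φ.comp D.H.val) M ψ) {n : A} (hn : n ∈ D.Np) :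
    φ n • m ∈ weightSum (φ.comp D.H.val) M {ψ}ᶜ := by
  suffices D.Np ≤ (weightSum (φ.comp D.H.val) M {ψ}ᶜ).comap (orbitMap φ m) from this hn
  refine iSup₂_le fun θ hθ => ?_
  rintro b ⟨_, hb⟩
  refine weightSpace_le_weightSum (S := {ψ}ᶜ) (χ := D.act θ ψ) (fun h => hθ ?_)
    (D.smul_mem_weightSpace_act φ hb hm)
  have := congrArg D.res (Set.mem_singleton_iff.1 h)
  rw [res_act] at this
  exact D.eq_zero_of_shift_eq this

/-- A nonzero weight vector `m` with `dim B₊ m` minimal is a highest weight vector: if `n m ≠ 0` for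
some homogeneous `n ∈ N₊`, then `B₊ n m = B₊ m` contains `m`, so `m ∈ N₊ m`. -/
theorem InO.exists_isHighest (hM : D.InO φ M) [Nontrivial M] :
    ∃ (χ : D.H →ₐ[k] k) (m : M), m ≠ 0 ∧ D.IsHighest φ χ m := by
  have hfin : ∀ m : M, FiniteDimensional k
      ((Subalgebra.toSubmodule D.Bp).map (orbitMap φ m)) := by
    intro m
    have := hM.locallyFinite m
    refine Submodule.finiteDimensional_of_le (S₂ := Submodule.span k
      {m' : M | ∃ b ∈ D.Bp, m' = φ b • m}) ?_
    rintro _ ⟨b, hb, rfl⟩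
    exact Submodule.subset_span ⟨b, hb, rfl⟩
  let S : Set M := {m | m ≠ 0 ∧ ∃ χ, m ∈ weightSpace (φ.comp D.H.val) M χ}
  have hS : S.Nonempty := by
    by_contra hS
    have : ∀ χ, weightSpace (φ.comp D.H.val) M χ = ⊥ := by
      intro χ
      by_contra hχ
      obtain ⟨m, hm, h0⟩ := Submodule.exists_mem_ne_zero_of_ne_bot hχ
      exact hS ⟨m, h0, χ, hm⟩
    have hs := hM.semisimple
    simp only [IsHSemisimple, this, iSup_bot] at hs
    exact bot_ne_top hs
  let d : M → ℕ := fun m =>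
    Module.finrank k ((Subalgebra.toSubmodule D.Bp).map (orbitMap φ m))
  obtain ⟨m, ⟨h0, χ, hχ⟩, hmin⟩ : ∃ m ∈ S, ∀ m' ∈ S, d m ≤ d m' := by
    obtain ⟨m, hm, hmin⟩ := (InvImage.wf d wellFounded_lt).has_min S hS
    exact ⟨m, hm, fun m' hm' => not_lt.1 (hmin m' hm')⟩
  refine ⟨χ, m, h0, hχ, fun n hn => ?_⟩
  suffices D.Np ≤ LinearMap.ker (orbitMap φ m) from this hn
  refine iSup₂_le fun θ hθ => ?_
  rintro n ⟨hn, hnθ⟩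
  by_contra hnm
  have hle : (Subalgebra.toSubmodule D.Bp).map (orbitMap φ (φ n • m)) ≤
      (Subalgebra.toSubmodule D.Bp).map (orbitMap φ m) := by
    rintro _ ⟨b, hb, rfl⟩
    refine ⟨b * n, D.Bp.mul_mem hb hn, ?_⟩
    rw [orbitMap_apply, orbitMap_apply, map_mul, mul_smul]
  have heq := Submodule.eq_of_le_of_finrank_le hle
    (hmin _ ⟨hnm, _, D.smul_mem_weightSpace_act φ hnθ hχ⟩)
  have hm : m ∈ (Subalgebra.toSubmodule D.Bp).map (orbitMap φ m) :=
    ⟨1, one_mem D.Bp, by rw [orbitMap_apply, map_one, one_smul]⟩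
  rw [← heq] at hm
  obtain ⟨b, hb, hbm⟩ := hm
  rw [orbitMap_apply, ← mul_smul, ← map_mul] at hbm
  refine h0 (eq_zero_of_mem_weightSum disjoint_compl_right
    (weightSpace_le_weightSum (Set.mem_singleton χ) hχ) ?_)
  have := Np_smul_mem_weightSum hχ
    (D.Bp_mul_Np (Submodule.mul_mem_mul hb (D.mem_Np hn hnθ hθ)))
  rwa [hbm] at this

end ExistsHighest

section Classification

variable {k A P P₀ : Type*} {r : ℕ} [Field k] [Ring A] [Algebra k A] [Group P] [AddCommGroup P₀]
variable {D : RTA k A P P₀ r} {Γ : Type*} [Group Γ] [MulSemiringAction Γ A] [SMulCommClass Γ k A]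

/-- The universal property of `Z(x)`, for the existence of homomorphisms. -/
theorem exists_hom_of_Z (x : RTA.X.{w} D Γ) {M : Type*} [AddCommGroup M] [Module k M]
    [Module (SkewMonoidAlgebra A Γ) M] [IsScalarTower k (SkewMonoidAlgebra A Γ) M]
    (f : x.carrier →ₗ[k] M)
    (hf : ∀ (s : D.HΓ Γ) e, f (s • e) = (s : SkewMonoidAlgebra A Γ) • f e)
    (hN : ∀ n ∈ D.Np, ∀ e, toSkew k A Γ n • f e = 0) :
    ∃ F : Z x →ₗ[SkewMonoidAlgebra A Γ] M, ∀ e, F (vermaTop x e) = f e := by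
  let F₀ : SkewMonoidAlgebra A Γ ⊗[k] x.carrier →ₗ[SkewMonoidAlgebra A Γ] M :=
    TensorProduct.AlgebraTensorModule.lift
      (LinearMap.toSpanSingleton (SkewMonoidAlgebra A Γ) (x.carrier →ₗ[k] M) f)
  have hF₀ : ∀ s e, F₀ (s ⊗ₜ e) = s • f e := fun s e => rfl
  refine ⟨(D.vermaRel Γ x.carrier).liftQ F₀ ?_, fun e => ?_⟩
  · refine Submodule.span_le.2 ?_
    rintro _ (⟨s, e, rfl⟩ | ⟨n, hn, e, rfl⟩)
    · change F₀ _ = 0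
      rw [map_sub, hF₀, hF₀, one_smul, hf, sub_self]
    · exact hN n hn e
  · change F₀ (1 ⊗ₜ e) = f e
    rw [hF₀, one_smul]

/-- Every simple module in `𝒪` is a quotient of some `Z(x)`: take for `M_x` a simple submodule of
the finite-dimensional `H ⋊ Γ`-module generated by a highest weight vector. -/
theorem exists_equiv_V (hΓ : D.SkewCompatible Γ) (M : Type w) [AddCommGroup M] [Module k M]
    [Module (SkewMonoidAlgebra A Γ) M] [IsScalarTower k (SkewMonoidAlgebra A Γ) M]
    (hM : D.InO (toSkew k A Γ) M) (hs : IsSimpleModule (SkewMonoidAlgebra A Γ) M) :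
    ∃ x : RTA.X.{w} D Γ, Nonempty (M ≃ₗ[SkewMonoidAlgebra A Γ] V x) := by
  have hnt := IsSimpleModule.nontrivial (SkewMonoidAlgebra A Γ) M
  have hfinΓ := hΓ.finite
  obtain ⟨χ, m, h0, hm⟩ := hM.exists_isHighest
  have hss : IsHSemisimple (D.toHΓ Γ) M := hM.semisimple
  let E₀ : Submodule k M := Submodule.span k (Set.range fun γ : Γ => SkewMonoidAlgebra.of A Γ γ • m)
  have hgen : ∀ N : Submodule k M, (∀ γ : Γ, SkewMonoidAlgebra.of A Γ γ • m ∈ N) → E₀ ≤ N := by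
    intro N hN
    rw [Submodule.span_le]
    rintro _ ⟨γ, rfl⟩
    exact hN γ
  have hmem : ∀ γ : Γ, SkewMonoidAlgebra.of A Γ γ • m ∈ E₀ := fun γ =>
    Submodule.subset_span ⟨γ, rfl⟩
  have hstable : ∀ s : D.HΓ Γ, ∀ e ∈ E₀, s • e ∈ E₀ := by
    refine D.HΓ_smul_mem (fun h => ?_) (fun γ => ?_)
    · refine hgen (E₀.comap (Algebra.lsmul k k M (D.toHΓ Γ h))) fun γ => ?_
      have : toSkew k A Γ h • SkewMonoidAlgebra.of A Γ γ • m =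
        dualAct D.H hΓ.smul_H γ χ h • SkewMonoidAlgebra.of A Γ γ • m := (hm.of_smul hΓ γ).weight h
      change toSkew k A Γ h • SkewMonoidAlgebra.of A Γ γ • m ∈ E₀
      rw [this]
      exact E₀.smul_mem _ (hmem γ)
    · refine hgen (E₀.comap (Algebra.lsmul k k M (D.ofHΓ Γ γ))) fun γ' => ?_
      change SkewMonoidAlgebra.of A Γ γ • SkewMonoidAlgebra.of A Γ γ' • m ∈ E₀
      rw [← mul_smul, ← map_mul]
      exact hmem _
  let E : Submodule (D.HΓ Γ) M := { E₀ with smul_mem' := fun s e he => hstable s e he }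
  have hEfin : FiniteDimensional k E :=
    FiniteDimensional.span_of_finite k
      (Set.finite_range fun γ : Γ => SkewMonoidAlgebra.of A Γ γ • m)
  have hmE : m ∈ E := by
    have := hmem 1
    rwa [map_one, one_smul] at this
  have hEnt : Nontrivial E := ⟨⟨⟨m, hmE⟩, 0, fun h => h0 (congrArg Subtype.val h)⟩⟩
  have hart : IsArtinian (D.HΓ Γ) E := isArtinian_of_tower k inferInstance
  obtain ⟨E₁, hE₁⟩ := IsAtomic.exists_atom (Submodule (D.HΓ Γ) E)
  have hE₁s : IsSimpleModule (D.HΓ Γ) E₁ := isSimpleModule_iff_isAtom.2 hE₁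
  let f : E₁ →ₗ[D.HΓ Γ] M := E.subtype.comp E₁.subtype
  have hfinj : Function.Injective f := E.injective_subtype.comp E₁.injective_subtype
  let x : RTA.X.{w} D Γ :=
    { carrier := E₁
      finiteDimensional :=
        Module.Finite.of_injective (E₁.subtype.restrictScalars k) E₁.injective_subtype
      semisimple := hss.of_injective f hfinj
      simple := hE₁s }
  obtain ⟨F, hF⟩ := exists_hom_of_Z x (f.restrictScalars k) (fun s e => map_smul f s e) (by
    intro n hn e
    have : E₀ ≤ LinearMap.ker (Algebra.lsmul k k M (toSkew k A Γ n)) :=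
      hgen _ fun γ => (hm.of_smul hΓ γ).annihilated n hn
    exact this e.1.2)
  have hFne : F ≠ 0 := by
    rintro rfl
    have := IsSimpleModule.nontrivial (D.HΓ Γ) E₁
    obtain ⟨e, he⟩ := exists_ne (0 : E₁)
    refine he (hfinj ?_)
    rw [map_zero]
    exact (hF e).symm
  have hFs : Function.Surjective F := LinearMap.surjective_of_ne_zero hFne
  let e := F.quotKerEquivOfSurjective hFs
  have hco : IsCoatom (LinearMap.ker F) := by
    rw [← isSimpleModule_iff_isCoatom]
    exact IsSimpleModule.congr e
  have hker := (isCoatom_iff_Z hΓ x _).1 hco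
  exact ⟨x, ⟨e.symm.trans (Submodule.quotEquivOfEq _ _ hker)⟩⟩

end Classification

end RTA

namespace RTA

/-! ### Finite-dimensionality of the simple quotients -/

section FiniteDimensional

variable {k A P P₀ : Type*} {r : ℕ} [Field k] [Ring A] [Algebra k A] [Group P] [AddCommGroup P₀]
variable {D : RTA k A P P₀ r} {Γ : Type*} [Group Γ] [MulSemiringAction Γ A] [SMulCommClass Γ k A]
variable {x : RTA.X.{w} D Γ} {χ : D.H →ₐ[k] k} {e : x.carrier}

/-- `V_A(χ)` embeds into `V(x)` for every weight `χ` of `M_x`. -/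
theorem toSkew_smul_mem_sumProper_iff (hΓ : D.SkewCompatible Γ)
    (he : e ∈ weightSpace (D.toHΓ Γ) x.carrier χ) (h0 : e ≠ 0) {a : A} :
    toSkew k A Γ a • vermaTop x e ∈ sumProper (SkewMonoidAlgebra A Γ) (Z x) ↔
      a • D.vermaVector χ ∈ sumProper A (D.ZA χ) := by
  have hhigh := isHighest_vermaTop he
  have htop := isTopComponent_Z hΓ he h0
  constructor
  · intro h
    -- the elements of `A` mapping `e` into the maximal submodule form a proper left ideal
    let J : Submodule A A :=
      { (((sumProper (SkewMonoidAlgebra A Γ) (Z x)).restrictScalars k).comap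
          (orbitMap (toSkew k A Γ) (vermaTop x e))) with
        smul_mem' := fun s b (hb : toSkew k A Γ b • vermaTop x e ∈ sumProper _ (Z x)) => by
          change toSkew k A Γ (s * b) • vermaTop x e ∈ sumProper _ (Z x)
          rw [map_mul, mul_smul]
          exact Submodule.smul_mem _ _ hb }
    have hJ : D.vermaIdeal χ ≤ J := fun b hb => by
      change toSkew k A Γ b • vermaTop x e ∈ sumProper _ (Z x)
      rw [hhigh.smul_vermaIdeal hb]
      exact zero_mem _
    have hne : J.map (D.vermaIdeal χ).mkQ ≠ ⊤ := by
      intro hc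
      have h1 : (D.vermaIdeal χ).mkQ 1 ∈ J.map (D.vermaIdeal χ).mkQ := hc ▸ Submodule.mem_top
      rw [← Submodule.mem_comap, Submodule.comap_map_mkQ, sup_eq_right.2 hJ] at h1
      have h1 : toSkew k A Γ 1 • vermaTop x e ∈ sumProper _ (Z x) := h1
      rw [map_one, one_smul] at h1
      exact vermaTop_ne_zero hΓ he h0 (htop.eq_zero_of_mem_sumProper ⟨e, rfl⟩ h1)
    refine (le_sSup hne : _ ≤ sumProper A (D.ZA χ)) ⟨a, h, ?_⟩
    rw [smul_vermaVector]
    rfl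
  · intro h
    -- every translate of `a e` is a sum of vectors of strictly lower weights
    have hle : Submodule.span (SkewMonoidAlgebra A Γ) {toSkew k A Γ a • vermaTop x e} ≤
        sumProper (SkewMonoidAlgebra A Γ) (Z x) := by
      refine htop.le_sumProper fun z hz => ?_
      obtain ⟨s, rfl⟩ := Submodule.mem_span_singleton.1 hz
      clear hz
      induction s using SkewMonoidAlgebra.induction_on with
      | zero => rw [zero_smul]; exact zero_mem _
      | add y z hy hz => rw [add_smul]; exact add_mem hy hz
      | single γ b =>
        have h1 : SkewMonoidAlgebra.single γ b =
            SkewMonoidAlgebra.of A Γ γ * toSkew k A Γ (γ⁻¹ • b) := by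
          rw [of_mul_toSkew (k := k), smul_inv_smul, single_eq (k := k)]
        rw [h1, mul_smul, ← mul_smul (toSkew k A Γ _), ← map_mul]
        refine of_smul_mem_lower hΓ γ (hhigh.smul_mem_of_mem_sumProper ?_)
        rw [mul_smul]
        exact Submodule.smul_mem _ _ h
    exact hle (Submodule.mem_span_singleton_self _)

theorem finiteDimensional_V_iff (hΓ : D.SkewCompatible Γ) (hχ : x.IsWeight χ) :
    FiniteDimensional k (V x) ↔ FiniteDimensional k (D.VA χ) := by
  obtain ⟨e, he, h0⟩ := hχ.exists_ne_zero
  have hfinΓ := hΓ.finite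
  let πV := (sumProper (SkewMonoidAlgebra A Γ) (Z x)).mkQ
  let πA := (sumProper A (D.ZA χ)).mkQ
  have hker : LinearMap.ker (orbitMap (toSkew k A Γ) (πV (vermaTop x e))) =
      LinearMap.ker (orbitMap (AlgHom.id k A) (πA (D.vermaVector χ))) := by
    ext a
    rw [LinearMap.mem_ker, LinearMap.mem_ker, orbitMap_apply, orbitMap_apply, AlgHom.id_apply,
      ← map_smul πV, ← map_smul πA, Submodule.mkQ_apply, Submodule.mkQ_apply,
      Submodule.Quotient.mk_eq_zero, Submodule.Quotient.mk_eq_zero,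
      toSkew_smul_mem_sumProper_iff hΓ he h0]
  have hrange : LinearMap.range (orbitMap (AlgHom.id k A) (πA (D.vermaVector χ))) = ⊤ := by
    have := iSup_range_orbitMap_map (φ := AlgHom.id k A) (v := fun _ : Unit => D.vermaVector χ)
      (by rw [iSup_const, range_orbitMap_vermaVector]) πA (Submodule.mkQ_surjective _)
    rwa [iSup_const] at this
  let equiv : LinearMap.range (orbitMap (toSkew k A Γ) (πV (vermaTop x e))) ≃ₗ[k] D.VA χ :=
    (LinearMap.quotKerEquivRange _).symm.trans ((Submodule.quotEquivOfEq _ _ hker).trans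
      ((LinearMap.quotKerEquivRange _).trans (LinearEquiv.ofTop _ hrange)))
  constructor
  · intro h
    exact equiv.finiteDimensional
  · intro h
    have hW : FiniteDimensional k (LinearMap.range (orbitMap (toSkew k A Γ)
      (πV (vermaTop x e)))) := equiv.symm.finiteDimensional
    have htop := iSup_range_orbitMap_map (iSup_range_orbitMap_vermaTop hΓ he h0) πV
      (Submodule.mkQ_surjective _)
    have hγ : ∀ γ : Γ, FiniteDimensional k (LinearMap.range (orbitMap (toSkew k A Γ)
        (πV (vermaTop x (D.ofHΓ Γ γ • e))))) := by
      intro γ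
      refine Submodule.finiteDimensional_of_le (S₂ := (LinearMap.range (orbitMap (toSkew k A Γ)
        (πV (vermaTop x e)))).map (Algebra.lsmul k k (V x) (SkewMonoidAlgebra.of A Γ γ))) ?_
      rintro _ ⟨a, rfl⟩
      refine ⟨_, ⟨γ⁻¹ • a, rfl⟩, ?_⟩
      change SkewMonoidAlgebra.of A Γ γ • toSkew k A Γ (γ⁻¹ • a) • πV (vermaTop x e) = _
      rw [of_smul_toSkew_smul, smul_inv_smul, ← map_smul πV, ← D.coe_ofHΓ, coe_smul_vermaTop]
      rfl
    have : FiniteDimensional k (⊤ : Submodule k (V x)) := by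
      rw [← htop]
      infer_instance
    exact Submodule.topEquiv.finiteDimensional

end FiniteDimensional

end RTA

/-! ### Finite length over skew group rings -/

section FiniteLength

variable {A Γ : Type*} [Ring A] [Group Γ] [MulSemiringAction Γ A]
variable {M : Type*} [AddCommGroup M] [Module A M] [Module (SkewMonoidAlgebra A Γ) M]
  [IsScalarTower A (SkewMonoidAlgebra A Γ) M]

namespace SkewMonoidAlgebra

theorem single_smul (γ : Γ) (a : A) (m : M) : single γ a • m = a • of A Γ γ • m := by
  rw [← smul_assoc, smul_of]

theorem of_smul_smul (γ : Γ) (a : A) (m : M) :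
    of A Γ γ • a • m = (γ • a) • of A Γ γ • m := by
  rw [← single_smul, ← one_smul (SkewMonoidAlgebra A Γ) m, ← smul_assoc a, one_def, smul_single,
    ← mul_smul, ← mul_smul, of_apply, single_mul_single, single_mul_single]
  simp

/-- The order automorphism `N ↦ γ⁻¹ N` of the lattice of `A`-submodules of an
`A ⋊ Γ`-module. -/
noncomputable def twist (γ : Γ) : Submodule A M ≃o Submodule A M where
  toFun N :=
    { N.toAddSubgroup.comap (DistribSMul.toAddMonoidHom M (of A Γ γ)) with
      smul_mem' := fun a m (hm : of A Γ γ • m ∈ N) => by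
        change of A Γ γ • a • m ∈ N
        rw [of_smul_smul]
        exact N.smul_mem _ hm }
  invFun N :=
    { N.toAddSubgroup.comap (DistribSMul.toAddMonoidHom M (of A Γ γ⁻¹)) with
      smul_mem' := fun a m (hm : of A Γ γ⁻¹ • m ∈ N) => by
        change of A Γ γ⁻¹ • a • m ∈ N
        rw [of_smul_smul]
        exact N.smul_mem _ hm }
  left_inv N := by
    ext m
    change of A Γ γ • of A Γ γ⁻¹ • m ∈ N ↔ m ∈ N
    rw [← mul_smul, ← map_mul, mul_inv_cancel, map_one, one_smul]
  right_inv N := by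
    ext m
    change of A Γ γ⁻¹ • of A Γ γ • m ∈ N ↔ m ∈ N
    rw [← mul_smul, ← map_mul, inv_mul_cancel, map_one, one_smul]
  map_rel_iff' {N N'} := by
    refine ⟨fun h m hm => ?_, fun h m hm => h hm⟩
    have : of A Γ γ • of A Γ γ⁻¹ • m = m := by
      rw [← mul_smul, ← map_mul, mul_inv_cancel, map_one, one_smul]
    rw [← this] at hm ⊢
    exact h hm

theorem mem_twist {γ : Γ} {N : Submodule A M} {m : M} :
    m ∈ twist γ N ↔ of A Γ γ • m ∈ N := Iff.rfl

/-- The map of submodule lattices induced by `γ`, from submodules of `γ⁻¹ N` to submodules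
of `N`. -/
theorem exists_strictMono_twist (γ : Γ) (N : Submodule A M) :
    ∃ f : Submodule A (twist γ N) → Submodule A N, StrictMono f := by
  refine ⟨fun K => N.mapIic.symm ⟨(twist γ).symm ((twist γ N).mapIic K), ?_⟩, fun K K' h => ?_⟩
  · rw [Set.mem_Iic, OrderIso.symm_apply_le]
    exact ((twist γ N).mapIic K).2
  · rw [OrderIso.lt_iff_lt, Subtype.mk_lt_mk, OrderIso.lt_iff_lt, Subtype.coe_lt_coe,
      OrderIso.lt_iff_lt]
    exact h

theorem isNoetherian_twist (γ : Γ) (N : Submodule A M) [h : IsNoetherian A N] :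
    IsNoetherian A (twist γ N) := by
  obtain ⟨f, hf⟩ := exists_strictMono_twist γ N
  rw [isNoetherian_iff'] at h ⊢
  exact hf.wellFoundedGT

theorem isArtinian_twist (γ : Γ) (N : Submodule A M) [h : IsArtinian A N] :
    IsArtinian A (twist γ N) := by
  obtain ⟨f, hf⟩ := exists_strictMono_twist γ N
  exact hf.wellFoundedLT

theorem finite_of_isSimpleModule [Finite Γ] [IsSimpleModule (SkewMonoidAlgebra A Γ) M] :
    Module.Finite A M := by
  have := IsSimpleModule.nontrivial (SkewMonoidAlgebra A Γ) M
  obtain ⟨m, hm⟩ := exists_ne (0 : M)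
  refine ⟨⟨(Set.finite_range fun γ : Γ => of A Γ γ • m).toFinset, ?_⟩⟩
  rw [Set.Finite.coe_toFinset, eq_top_iff]
  rintro z -
  have hz : z ∈ Submodule.span (SkewMonoidAlgebra A Γ) {m} :=
    IsSimpleModule.span_singleton_eq_top (SkewMonoidAlgebra A Γ) hm ▸ Submodule.mem_top
  obtain ⟨s, rfl⟩ := Submodule.mem_span_singleton.1 hz
  clear hz
  induction s using SkewMonoidAlgebra.induction_on with
  | zero => rw [zero_smul]; exact zero_mem _
  | add y z hy hz => rw [add_smul]; exact add_mem hy hz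
  | single γ a =>
    rw [single_smul]
    exact Submodule.smul_mem _ _ (Submodule.subset_span ⟨γ, rfl⟩)

/-- Clifford theory: a simple `A ⋊ Γ`-module has a maximal `A`-submodule `N`, and embeds over `A`
into the product of the simple modules `M / γ N`, since `⋂ γ N` is stable under `A ⋊ Γ`. -/
theorem isNoetherian_isArtinian_of_isSimpleModule [Finite Γ]
    [IsSimpleModule (SkewMonoidAlgebra A Γ) M] : IsNoetherian A M ∧ IsArtinian A M := by
  have := IsSimpleModule.nontrivial (SkewMonoidAlgebra A Γ) M
  have := finite_of_isSimpleModule (A := A) (Γ := Γ) (M := M)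
  obtain ⟨N, hN⟩ := IsCoatomic.exists_coatom (Submodule A M)
  let K : Submodule (SkewMonoidAlgebra A Γ) M :=
    { (⨅ γ : Γ, twist γ N).toAddSubgroup with
      smul_mem' := fun s m (hm : m ∈ ⨅ γ : Γ, twist γ N) => by
        change s • m ∈ ⨅ γ : Γ, twist γ N
        induction s using SkewMonoidAlgebra.induction_on with
        | zero => rw [zero_smul]; exact zero_mem _
        | add y z hy hz => rw [add_smul]; exact add_mem hy hz
        | single γ a =>
          rw [single_smul]
          refine Submodule.smul_mem _ _ ?_
          rw [Submodule.mem_iInf] at hm ⊢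
          intro γ'
          rw [mem_twist, ← mul_smul, ← map_mul]
          exact hm (γ' * γ) }
  have hK : K = ⊥ := by
    refine (eq_bot_or_eq_top K).resolve_right fun hK => hN.1 ?_
    rw [eq_top_iff]
    intro m _
    have hm : m ∈ K := hK ▸ Submodule.mem_top
    have hm : m ∈ ⨅ γ : Γ, twist γ N := hm
    have := (Submodule.mem_iInf _).1 hm 1
    rwa [mem_twist, map_one, one_smul] at this
  have hsimple : ∀ γ : Γ, IsSimpleModule A (M ⧸ twist γ N) := fun γ => by
    rw [isSimpleModule_iff_isCoatom]
    exact (OrderIso.isCoatom_iff (twist γ) N).2 hN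
  let f : M →ₗ[A] (γ : Γ) → M ⧸ twist γ N := LinearMap.pi fun γ => (twist γ N).mkQ
  have hf : Function.Injective f := by
    rw [injective_iff_map_eq_zero]
    intro m hm
    have : m ∈ K := by
      change m ∈ ⨅ γ : Γ, twist γ N
      rw [Submodule.mem_iInf]
      intro γ
      exact (Submodule.Quotient.mk_eq_zero _).1 (congrFun hm γ)
    rwa [hK, Submodule.mem_bot] at this
  exact ⟨isNoetherian_of_injective f hf, isArtinian_of_injective f hf⟩

/-- If `M` is generated by the translates of an `A`-submodule of finite length, then it has finite
length over `A ⋊ Γ`. -/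
theorem isFiniteLength_of_iSup_twist [Finite Γ] (N : Submodule A M) (hN : IsFiniteLength A N)
    (h : ⨆ γ : Γ, twist γ N = ⊤) : IsFiniteLength (SkewMonoidAlgebra A Γ) M := by
  rw [isFiniteLength_iff_isNoetherian_isArtinian] at hN ⊢
  obtain ⟨_, _⟩ := hN
  have _ := fun γ : Γ => isNoetherian_twist γ N
  have _ := fun γ : Γ => isArtinian_twist γ N
  have h1 : IsNoetherian A (⊤ : Submodule A M) := h ▸ isNoetherian_iSup
  have h2 : IsArtinian A (⊤ : Submodule A M) := h ▸ isArtinian_iSup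
  exact ⟨isNoetherian_of_tower A (isNoetherian_of_linearEquiv Submodule.topEquiv),
    isArtinian_of_tower A (isArtinian_of_linearEquiv Submodule.topEquiv)⟩

section RestrictScalars

variable {A Γ : Type*} [Ring A] [Group Γ] [MulSemiringAction Γ A] {M : Type*} [AddCommGroup M]
  [Module (SkewMonoidAlgebra A Γ) M]

theorem isFiniteLength_restrictScalars [Finite Γ] (h : IsFiniteLength (SkewMonoidAlgebra A Γ) M)
    [Module A M] [IsScalarTower A (SkewMonoidAlgebra A Γ) M] : IsFiniteLength A M := by
  rw [isFiniteLength_iff_isNoetherian_isArtinian]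
  rename_i i₁ i₂
  revert i₁ i₂
  induction h with
  | of_subsingleton => intro _ _; exact ⟨inferInstance, inferInstance⟩
  | @of_simple_quotient M _ _ N _ _ ih =>
    intro _ _
    obtain ⟨_, _⟩ := ih
    obtain ⟨_, _⟩ := isNoetherian_isArtinian_of_isSimpleModule (A := A) (Γ := Γ) (M := M ⧸ N)
    have hex : LinearMap.range (N.subtype.restrictScalars A) =
        LinearMap.ker (N.mkQ.restrictScalars A) := by
      ext m
      simp
    exact ⟨isNoetherian_of_range_eq_ker _ _ hex, isArtinian_of_range_eq_ker _ _ hex⟩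

end RestrictScalars

end SkewMonoidAlgebra

end FiniteLength

namespace RTA

section VermaLength

variable {k A P P₀ : Type*} {r : ℕ} [Field k] [Ring A] [Algebra k A] [Group P] [AddCommGroup P₀]
variable {D : RTA k A P P₀ r} {Γ : Type*} [Group Γ] [MulSemiringAction Γ A] [SMulCommClass Γ k A]
variable {x : RTA.X.{w} D Γ} {χ : D.H →ₐ[k] k}

theorem isFiniteLength_Z_iff (hΓ : D.SkewCompatible Γ) (hχ : x.IsWeight χ) :
    IsFiniteLength (SkewMonoidAlgebra A Γ) (Z x) ↔ IsFiniteLength A (D.ZA χ) := by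
  obtain ⟨e, he, h0⟩ := hχ.exists_ne_zero
  have hfinΓ := hΓ.finite
  have hsmul : ∀ (a : A) (z : Z x), a • z = toSkew k A Γ a • z := fun a z => by
    rw [toSkew_apply, SkewMonoidAlgebra.single_smul, map_one, one_smul]
  let f : D.ZA χ →ₗ[A] Z x := (D.vermaIdeal χ).liftQ
    (LinearMap.toSpanSingleton A (Z x) (vermaTop x e)) fun a ha => by
      rw [LinearMap.mem_ker, LinearMap.toSpanSingleton_apply, hsmul]
      exact (toSkew_smul_vermaTop_eq_zero hΓ he h0).2 ha
  have hf : Function.Injective f := by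
    rw [injective_iff_map_eq_zero]
    intro z hz
    obtain ⟨a, rfl⟩ := Submodule.Quotient.mk_surjective _ z
    rw [Submodule.Quotient.mk_eq_zero, ← toSkew_smul_vermaTop_eq_zero hΓ he h0,
      ← hsmul]
    exact hz
  constructor
  · intro h
    exact (SkewMonoidAlgebra.isFiniteLength_restrictScalars h).of_injective hf
  · intro h
    refine SkewMonoidAlgebra.isFiniteLength_of_iSup_twist (LinearMap.range f)
      (h.of_surjective f.surjective_rangeRestrict) ?_
    have htop : (⊤ : Submodule k (Z x)) ≤
        { (⨆ γ : Γ, SkewMonoidAlgebra.twist γ (LinearMap.range f)).toAddSubgroup with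
          smul_mem' := fun c z (hz : z ∈ ⨆ γ : Γ, SkewMonoidAlgebra.twist γ _) => by
            have := Submodule.smul_mem _ (algebraMap k A c) hz
            rw [hsmul, AlgHom.commutes, algebraMap_smul] at this
            exact this } := by
      rw [← iSup_range_orbitMap_vermaTop hΓ he h0]
      refine iSup_le fun γ => ?_
      rintro _ ⟨a, rfl⟩
      refine Submodule.mem_iSup_of_mem γ⁻¹ ?_
      rw [SkewMonoidAlgebra.mem_twist, orbitMap_apply, of_smul_toSkew_smul, ← coe_smul_vermaTop, coe_ofHΓ, ← mul_smul (SkewMonoidAlgebra.of _ _ _),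
        ← map_mul, inv_mul_cancel, map_one, one_smul]
      exact ⟨Submodule.Quotient.mk (γ⁻¹ • a), hsmul (γ⁻¹ • a) (vermaTop x e)⟩
    rw [eq_top_iff]
    exact fun z _ => htop Submodule.mem_top

end VermaLength

end RTA

theorem theorem7 {k A P P₀ : Type*} {r : ℕ}
    [Field k] [Ring A] [Algebra k A] [Group P] [AddCommGroup P₀] (D : RTA k A P P₀ r)
    (Γ : Type*) [Group Γ] [MulSemiringAction Γ A] [SMulCommClass Γ k A]
    (hΓ : D.SkewCompatible Γ) :
    -- `Z(x)` lies in `𝒪`, and it has a unique simple quotient, namely `V(x)`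
    (∀ x : RTA.X.{w} D Γ,
      D.InO (RTA.toSkew k A Γ) (RTA.Z x) ∧ D.InO (RTA.toSkew k A Γ) (RTA.V x) ∧
      ∀ N : Submodule (SkewMonoidAlgebra A Γ) (RTA.Z x),
        IsCoatom N ↔ N = RTA.sumProper (SkewMonoidAlgebra A Γ) (RTA.Z x)) ∧
    -- `Z_A(χ)` lies in `𝒪_A`, and it has a unique simple quotient, namely `V_A(χ)`
    (∀ χ : D.H →ₐ[k] k,
      D.InO (AlgHom.id k A) (D.ZA χ) ∧ D.InO (AlgHom.id k A) (D.VA χ) ∧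
      ∀ N : Submodule A (D.ZA χ), IsCoatom N ↔ N = RTA.sumProper A (D.ZA χ)) ∧
    -- every simple module in `𝒪` is some `V(x)`
    (∀ (M : Type w) [AddCommGroup M] [Module k M] [Module (SkewMonoidAlgebra A Γ) M]
      [IsScalarTower k (SkewMonoidAlgebra A Γ) M],
      D.InO (RTA.toSkew k A Γ) M → IsSimpleModule (SkewMonoidAlgebra A Γ) M →
      ∃ x : RTA.X.{w} D Γ, Nonempty (M ≃ₗ[SkewMonoidAlgebra A Γ] RTA.V x)) ∧
    -- `V(x)` is finite-dimensional iff `V_A(λ_x)` is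
    (∀ (x : RTA.X.{w} D Γ) (χ : D.H →ₐ[k] k), x.IsWeight χ →
      (FiniteDimensional k (RTA.V x) ↔ FiniteDimensional k (D.VA χ))) ∧
    -- `Z(x)` has finite length iff `Z_A(λ_x)` does
    (∀ (x : RTA.X.{w} D Γ) (χ : D.H →ₐ[k] k), x.IsWeight χ →
      (IsFiniteLength (SkewMonoidAlgebra A Γ) (RTA.Z x) ↔ IsFiniteLength A (D.ZA χ))) := by
  exact ⟨fun x => ⟨RTA.inO_Z hΓ x, RTA.inO_V hΓ x, RTA.isCoatom_iff_Z hΓ x⟩,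
    fun χ => ⟨D.inO_ZA χ, D.inO_VA χ, (D.isTopComponent_ZA χ).isCoatom_iff⟩,
    fun M _ _ _ _ hM hs => RTA.exists_equiv_V hΓ M hM hs,
    fun _ _ hχ => RTA.finiteDimensional_V_iff hΓ hχ,
    fun _ _ hχ => RTA.isFiniteLength_Z_iff hΓ hχ⟩
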